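/- Let $n\ge 2$ and let $W=I_n$ be the dihedral group of order $2n$ with its Coxeter generating set $S=\{1,2\}$, so that $m_{1,2}=n$. Let $H_q$ be the Hecke algebra of $(W,S)$ over $\mathbb Z[q]$, with generators $T_s$ ($s\in S$) subject to $T_s^2=(q-1)T_s+q$ and the braid relation $T_1T_2T_1\cdots=T_2T_1T_2\cdots$ ($n$ factors on each side). For $I\subseteq S$ let $W_I=\langle I\rangle$ and $x_I=\sum_{w\in W_I}T_w$, where $T_w=T_{s_1}\cdots T_{s_l}$ for a reduced expression $w=s_1\cdots s_l$. Let $$E_q(I_n)=\mathrm{End}_{H_q}\Big(\bigoplus_{I\subseteq S}x_IH_q\Big)$$ be the endomorphism algebra of this right $H_q$-module. Let $\mathcal Q$ be the quiver whose vertices are the subsets of $S$, with an arrow $\delta_{J,I}$ from $I$ to $J$ and an arrow $\upsilon_{I,J}$ from $J$ to $I$ for all $I\subset J\subseteq S$ with $|J|=|I|+1$. Let $\mathcal Q_q=\mathbb Z[q]\mathcal Q$ be its path algebra over $\mathbb Z[q]$, with $e_K$ the trivial path at $K$; a product $pp'$ of paths is the path $p'$ followed by $p$ (and $0$ if $p'$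 does not end where $p$ starts). Write $\delta_{\{i\}}=\delta_{\{i\},\emptyset}$, $\upsilon_{\{i\}}=\upsilon_{\emptyset,\{i\}}$ and $\chi_i=\upsilon_{\{i\}}\delta_{\{i\}}$. For $\{s,t\}=S$ and $j\ge 1$ let $\chi_{[j]t}=\cdots\chi_t\chi_s\chi_t$ be the alternating product with $j$ factors whose last factor is $\chi_t$, and let $\chi_{[0]t}=e_\emptyset$. For $1\le j\le n$ let $b^n_j=\binom{n-i-1}{i}(-q)^i$ if $n-j=2i$ with an integer $i\geq 0$, and $b^n_j=0$ if $n-j$ is odd. **Theorem.** The $\mathbb Z[q]$-algebra $E_q(I_n)$ is isomorphic to the quotient of the path algebra $\mathcal Q_q$ by the two-sided ideal generated by the following relations. 1. Quasi-idempotent relations: for $i=1,2$, (i) $\delta_{\{i\}}\upsilon_{\{i\}}=(1+q)\,e_{\{i\}}$; (ii) $\delta_{\{1,2\},\{i\}}\upsilon_{\{i\},\{1,2\}}=(1+q+\cdots+q^{n-1})\,e_{\{1,2\}}$. 2. Sandwich relations: (i) $\upsilon_{\{1\}}\upsilon_{\{1\},\{1,2\}}=\upsilon_{\{2\}}\upsilon_{\{2\},\{1,2\}}$;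 (ii) $\delta_{\{1,2\},\{1\}}\delta_{\{1\}}=\delta_{\{1,2\},\{2\}}\delta_{\{2\}}$. 3. Refined braid relations: for both $(s,t)=(1,2)$ and $(s,t)=(2,1)$, (i) if $n$ is even, $\upsilon_{\{t\},\{1,2\}}\delta_{\{1,2\},\{s\}}=\delta_{\{t\}}\Big(\sum_{j=2}^n b^n_j\,\chi_{[j-2]t}\Big)\upsilon_{\{s\}}$; (ii) if $n$ is odd, $\upsilon_{\{s\},\{1,2\}}\delta_{\{1,2\},\{s\}}=\delta_{\{s\}}\Big(\sum_{j=3}^n b^n_j\,\chi_{[j-2]t}\Big)\upsilon_{\{s\}}+(-q)^{\frac{n-1}2}e_{\{s\}}$. -/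

import Mathlib

open Polynomial

noncomputable section

namespace HeckeEndo

/-! ### Path algebras -/

section PathAlgebra

/-- A path in the quiver `V`, together with its source `p.1` and its target `p.2.1`. -/
abbrev TotalPath (V : Type*) [Quiver V] := Σ a b : V, Quiver.Path a b

/-- The path algebra of the quiver `V` over `R`: the free `R`-module on all paths.
It is a unital algebra when `V` has finitely many vertices. -/
def PathAlgebra (R V : Type*) [CommRing R] [Quiver V] := TotalPath V →₀ R

variable {R V : Type*} [CommRing R] [Quiver V]

instance : AddCommGroup (PathAlgebra R V) := inferInstanceAs (AddCommGroup (TotalPath V →₀ R))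
instance : Module R (PathAlgebra R V) := inferInstanceAs (Module R (TotalPath V →₀ R))

namespace PathAlgebra

/-- The basis of the path algebra consisting of all paths. -/
def pathBasis : Module.Basis (TotalPath V) R (PathAlgebra R V) :=
  Module.Basis.ofRepr (LinearEquiv.refl R (TotalPath V →₀ R))

/-- The basis element given by a path. -/
def ofPath (p : TotalPath V) : PathAlgebra R V := pathBasis p

open Classical in
/-- The product of two paths. Paths are multiplied like maps: `p * q` is `q` followed by `p`
if `q` ends where `p` starts, and it is `0` otherwise. -/
def mulPath (p q : TotalPath V) : PathAlgebra R V :=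
  if h : q.2.1 = p.1 then ofPath ⟨q.1, p.2.1, (q.2.2.cast rfl h).comp p.2.2⟩ else 0

/-- The bilinear extension of the product of paths. -/
def mulBilin : PathAlgebra R V →ₗ[R] PathAlgebra R V →ₗ[R] PathAlgebra R V :=
  pathBasis.constr R fun p => pathBasis.constr R fun q => mulPath p q

instance : Mul (PathAlgebra R V) := ⟨fun x y => mulBilin x y⟩

theorem mul_def (x y : PathAlgebra R V) : x * y = mulBilin x y := rfl

theorem ofPath_mul_ofPath (p q : TotalPath V) :
    (ofPath p * ofPath q : PathAlgebra R V) = mulPath p q := by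
  simp [mul_def, mulBilin, ofPath]

theorem mulPath_comp {a b c : V} (p : Quiver.Path b c) (q : Quiver.Path a b) :
    (mulPath ⟨b, c, p⟩ ⟨a, b, q⟩ : PathAlgebra R V) = ofPath ⟨a, c, q.comp p⟩ := by
  simp [mulPath]

theorem mulPath_of_ne (p q : TotalPath V) (h : q.2.1 ≠ p.1) :
    (mulPath p q : PathAlgebra R V) = 0 := by
  simp [mulPath, h]

theorem induction_on {P : PathAlgebra R V → Prop} (x : PathAlgebra R V)
    (path : ∀ p, P (ofPath p)) (zero : P 0) (add : ∀ y z, P y → P z → P (y + z))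
    (smul : ∀ (r : R) y, P y → P (r • y)) : P x := by
  refine Submodule.span_induction (p := fun y _ => P y) ?_ zero (fun y z _ _ => add y z)
    (fun r y _ => smul r y) (pathBasis.mem_span x)
  rintro _ ⟨p, rfl⟩
  exact path p

theorem add_mul' (x y z : PathAlgebra R V) : (x + y) * z = x * z + y * z := by
  simp [mul_def]

theorem mul_add' (x y z : PathAlgebra R V) : x * (y + z) = x * y + x * z := by
  simp [mul_def]

theorem smul_mul' (r : R) (x y : PathAlgebra R V) : (r • x) * y = r • (x * y) := by
  simp [mul_def]

theorem mul_smul' (r : R) (x y : PathAlgebra R V) : x * (r • y) = r • (x * y) := by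
  simp [mul_def]

theorem zero_mul' (x : PathAlgebra R V) : 0 * x = 0 := by simp [mul_def]

theorem mul_zero' (x : PathAlgebra R V) : x * 0 = 0 := by simp [mul_def]

theorem mul_assoc' (x y z : PathAlgebra R V) : x * y * z = x * (y * z) := by
  induction x using induction_on with
  | zero => simp only [zero_mul']
  | add _ _ h h' => simp only [add_mul', h, h']
  | smul r _ h => simp only [smul_mul', h]
  | path p
  induction y using induction_on with
  | zero => simp only [zero_mul', mul_zero']
  | add _ _ h h' => simp only [add_mul', mul_add', h, h']
  | smul r _ h => simp only [smul_mul', mul_smul', h]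
  | path q
  induction z using induction_on with
  | zero => simp only [mul_zero']
  | add _ _ h h' => simp only [mul_add', h, h']
  | smul r _ h => simp only [mul_smul', h]
  | path s
  obtain ⟨b, c, p⟩ := p
  obtain ⟨b', c', q⟩ := q
  obtain ⟨b'', c'', s⟩ := s
  simp only [ofPath_mul_ofPath]
  by_cases h : c' = b
  · subst h
    by_cases h' : c'' = b'
    · subst h'
      simp only [mulPath_comp, ofPath_mul_ofPath, Quiver.Path.comp_assoc]
    · rw [mulPath_comp, ofPath_mul_ofPath, mulPath_of_ne _ _ h', mulPath_of_ne _ _ h', mul_zero']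
  · rw [mulPath_of_ne _ _ h, zero_mul']
    by_cases h' : c'' = b'
    · subst h'
      rw [mulPath_comp, ofPath_mul_ofPath, mulPath_of_ne _ _ h]
    · rw [mulPath_of_ne _ _ h', mul_zero']

/-- The trivial path `e_a` at the vertex `a`. -/
def e (a : V) : PathAlgebra R V := ofPath ⟨a, a, Quiver.Path.nil⟩

/-- The basis element given by an arrow. -/
def arrow {a b : V} (f : a ⟶ b) : PathAlgebra R V := ofPath ⟨a, b, f.toPath⟩

variable [Fintype V]

instance : One (PathAlgebra R V) := ⟨∑ a : V, e a⟩

theorem one_def : (1 : PathAlgebra R V) = ∑ a : V, e a := rfl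

theorem one_mul' (x : PathAlgebra R V) : 1 * x = x := by
  induction x using induction_on with
  | zero => rw [mul_zero']
  | add _ _ h h' => rw [mul_add', h, h']
  | smul r _ h => rw [mul_smul', h]
  | path p
  obtain ⟨a, b, p⟩ := p
  rw [one_def, mul_def, map_sum, LinearMap.sum_apply, Finset.sum_eq_single b]
  · change (ofPath ⟨b, b, Quiver.Path.nil⟩ * ofPath ⟨a, b, p⟩ : PathAlgebra R V) = _
    rw [ofPath_mul_ofPath, mulPath_comp, Quiver.Path.comp_nil]
  · intro c _ hc
    change (ofPath ⟨c, c, Quiver.Path.nil⟩ * ofPath ⟨a, b, p⟩ : PathAlgebra R V) = _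
    rw [ofPath_mul_ofPath, mulPath_of_ne _ _ hc.symm]
  · simp

theorem mul_one' (x : PathAlgebra R V) : x * 1 = x := by
  induction x using induction_on with
  | zero => rw [zero_mul']
  | add _ _ h h' => rw [add_mul', h, h']
  | smul r _ h => rw [smul_mul', h]
  | path p
  obtain ⟨a, b, p⟩ := p
  rw [one_def, mul_def, map_sum, Finset.sum_eq_single a]
  · change (ofPath ⟨a, b, p⟩ * ofPath ⟨a, a, Quiver.Path.nil⟩ : PathAlgebra R V) = _
    rw [ofPath_mul_ofPath, mulPath_comp, Quiver.Path.nil_comp]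
  · intro c _ hc
    change (ofPath ⟨a, b, p⟩ * ofPath ⟨c, c, Quiver.Path.nil⟩ : PathAlgebra R V) = _
    rw [ofPath_mul_ofPath, mulPath_of_ne _ _ hc]
  · simp

instance : Ring (PathAlgebra R V) :=
  { (inferInstance : AddCommGroup (PathAlgebra R V)) with
    left_distrib := mul_add'
    right_distrib := add_mul'
    zero_mul := zero_mul'
    mul_zero := mul_zero'
    mul_assoc := mul_assoc'
    one_mul := one_mul'
    mul_one := mul_one' }

instance : Algebra R (PathAlgebra R V) := Algebra.ofModule smul_mul' fun r x y => mul_smul' r x y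

end PathAlgebra

end PathAlgebra

/-! ### Hecke algebras and Hecke endomorphism algebras -/

section Hecke

variable {B : Type*} {W : Type*} [Group W] {M : CoxeterMatrix B}

/-- The Hecke relations: `T_s² = (q - 1) T_s + q`, and the braid relations for `s ≠ t` with
`m_{s,t}` finite (Mathlib's convention is `M s t = 0` if `m_{s,t}` is infinite).
The polynomial variable `X` of `ℤ[X]` plays the role of `q`. -/
inductive HeckeRel (M : CoxeterMatrix B) : FreeAlgebra ℤ[X] B → FreeAlgebra ℤ[X] B → Prop
  | quadratic (s : B) : HeckeRel M
      (FreeAlgebra.ι ℤ[X] s * FreeAlgebra.ι ℤ[X] s)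
      (((X : ℤ[X]) - 1) • FreeAlgebra.ι ℤ[X] s + algebraMap ℤ[X] (FreeAlgebra ℤ[X] B) X)
  | braid (s t : B) (hst : s ≠ t) (hm : M s t ≠ 0) : HeckeRel M
      ((CoxeterSystem.alternatingWord s t (M s t)).map (FreeAlgebra.ι ℤ[X])).prod
      ((CoxeterSystem.alternatingWord t s (M s t)).map (FreeAlgebra.ι ℤ[X])).prod

/-- The Hecke algebra `H_q` over `ℤ[q]`. -/
abbrev Hecke (M : CoxeterMatrix B) := RingQuot (HeckeRel M)

/-- The generator `T_s` of the Hecke algebra. -/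
def Hecke.gen (M : CoxeterMatrix B) (s : B) : Hecke M :=
  RingQuot.mkAlgHom ℤ[X] (HeckeRel M) (FreeAlgebra.ι ℤ[X] s)

theorem exists_reduced (cs : CoxeterSystem M W) (w : W) :
    ∃ ω : List B, cs.IsReduced ω ∧ cs.wordProd ω = w := by
  obtain ⟨ω, h, h'⟩ := cs.exists_isReduced w
  exact ⟨ω, h, h'.symm⟩

/-- The element `T_w = T_{s₁} ⋯ T_{s_l}` of the Hecke algebra, for a reduced expression
`w = s₁ ⋯ s_l` (it does not depend on the reduced expression, by Matsumoto's theorem). -/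
def heckeT (cs : CoxeterSystem M W) (w : W) : Hecke M :=
  ((exists_reduced cs w).choose.map (Hecke.gen M)).prod

/-- The parabolic subgroup `W_I`. -/
def parabolic (cs : CoxeterSystem M W) (I : Finset B) : Subgroup W :=
  Subgroup.closure (cs.simple '' (I : Set B))

/-- The set `Λ(W)` of finitary subsets of `S`. -/
def Finitary (cs : CoxeterSystem M W) := {I : Finset B // (parabolic cs I : Set W).Finite}

instance [Finite B] (cs : CoxeterSystem M W) : Finite (Finitary cs) :=
  inferInstanceAs (Finite {I : Finset B // (parabolic cs I : Set W).Finite})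

instance [Finite B] (cs : CoxeterSystem M W) : Fintype (Finitary cs) := Fintype.ofFinite _

/-- `x_I = ∑_{w ∈ W_I} T_w`. -/
def heckeX (cs : CoxeterSystem M W) (I : Finitary cs) : Hecke M :=
  ∑ w ∈ I.2.toFinset, heckeT cs w

/-- The right ideal `x_I H_q`, as a right `H_q`-module. -/
abbrev heckeIdeal (cs : CoxeterSystem M W) (I : Finitary cs) : Submodule (Hecke M)ᵐᵒᵖ (Hecke M) :=
  Submodule.span (Hecke M)ᵐᵒᵖ {heckeX cs I}

/-- The Hecke endomorphism algebra `E_q(W) = End_{H_q}(⨁_{I ∈ Λ} x_I H_q)`. -/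
abbrev HeckeEnd (cs : CoxeterSystem M W) :=
  Module.End (Hecke M)ᵐᵒᵖ (DirectSum (Finitary cs) fun I => heckeIdeal cs I)

/-! ### The Hasse quiver -/

/-- `I ⊏ J` : `I ⊂ J` and `|I| = |J| - 1`. -/
def Covers {cs : CoxeterSystem M W} (I J : Finitary cs) : Prop :=
  I.1 ⊆ J.1 ∧ I.1.card + 1 = J.1.card

/-- The Hasse quiver: for every `I ⊏ J` there is one arrow `δ_{J,I}` from `I` to `J`
and one arrow `υ_{I,J}` from `J` to `I`. -/
instance (cs : CoxeterSystem M W) : Quiver (Finitary cs) where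
  Hom I J := PLift (Covers I J) ⊕ PLift (Covers J I)

/-- The path algebra `𝒬_q` of the Hasse quiver over `ℤ[q]`. -/
abbrev HassePath (cs : CoxeterSystem M W) := PathAlgebra ℤ[X] (Finitary cs)

/-- The arrow `δ_{J,I} : I → J`, for `I ⊏ J`. -/
def delta {cs : CoxeterSystem M W} {I J : Finitary cs} (h : Covers I J) : HassePath cs :=
  PathAlgebra.arrow (a := I) (b := J) (Sum.inl ⟨h⟩)

/-- The arrow `υ_{I,J} : J → I`, for `I ⊏ J`. -/
def upsilon {cs : CoxeterSystem M W} {I J : Finitary cs} (h : Covers I J) : HassePath cs :=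
  PathAlgebra.arrow (a := J) (b := I) (Sum.inr ⟨h⟩)

end Hecke

/-! ### The finite dihedral case -/

section Dihedral

variable {W : Type*} [Group W] {M : CoxeterMatrix (Fin 2)}

theorem finite_of_dihedral (cs : CoxeterSystem M W) (hM : M 0 1 ≠ 0) : Finite W := by
  have hs (i : Fin 2) : cs.simple i * cs.simple i = 1 := cs.simple_mul_simple_self i
  set r : W := cs.simple 0 * cs.simple 1 with hr
  have hfin : (Subgroup.zpowers r : Set W).Finite := by
    rw [finite_zpowers, isOfFinOrder_iff_pow_eq_one]
    exact ⟨M 0 1, Nat.pos_of_ne_zero hM, cs.simple_mul_simple_pow 0 1⟩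
  have hU : ((Subgroup.zpowers r : Set W) ∪
      (fun w => w * cs.simple 0) '' (Subgroup.zpowers r : Set W)).Finite :=
    hfin.union (hfin.image _)
  have hinv : r⁻¹ = cs.simple 1 * cs.simple 0 := by simp [hr]
  have hr' : r⁻¹ ∈ Subgroup.zpowers r := inv_mem (Subgroup.mem_zpowers r)
  refine Set.finite_univ_iff.mp (hU.subset fun w _ => ?_)
  refine cs.simple_induction_right w (Or.inl (one_mem _)) ?_
  rintro w i (hw | ⟨v, hv, rfl⟩)
  · fin_cases i
    · exact Or.inr ⟨w, hw, rfl⟩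
    · refine Or.inr ⟨w * r⁻¹, mul_mem hw hr', ?_⟩
      simp [hinv, mul_assoc]
  · fin_cases i
    · refine Or.inl ?_
      simpa [mul_assoc] using hv
    · refine Or.inl ?_
      simpa [hr, mul_assoc] using mul_mem hv (Subgroup.mem_zpowers r)

/-- The vertex `∅` of the Hasse quiver. -/
def vBot (cs : CoxeterSystem M W) (hM : M 0 1 ≠ 0) : Finitary cs :=
  ⟨∅, haveI := finite_of_dihedral cs hM; Set.toFinite _⟩

/-- The vertex `{i}` of the Hasse quiver. -/
def vMid (cs : CoxeterSystem M W) (hM : M 0 1 ≠ 0) (i : Fin 2) : Finitary cs :=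
  ⟨{i}, haveI := finite_of_dihedral cs hM; Set.toFinite _⟩

/-- The vertex `S` of the Hasse quiver, where `S` consists of the two simple reflections. -/
def vTop (cs : CoxeterSystem M W) (hM : M 0 1 ≠ 0) : Finitary cs :=
  ⟨Finset.univ, haveI := finite_of_dihedral cs hM; Set.toFinite _⟩

theorem covers_bot (cs : CoxeterSystem M W) (hM : M 0 1 ≠ 0) (i : Fin 2) :
    Covers (vBot cs hM) (vMid cs hM i) := by simp [Covers, vBot, vMid]

theorem covers_top (cs : CoxeterSystem M W) (hM : M 0 1 ≠ 0) (i : Fin 2) :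
    Covers (vMid cs hM i) (vTop cs hM) := by simp [Covers, vTop, vMid]

variable (cs : CoxeterSystem M W) (hM : M 0 1 ≠ 0)

/-- `δ_{i} : ∅ → {i}` -/
def dBot (i : Fin 2) : HassePath cs := delta (covers_bot cs hM i)

/-- `υ_{i} : {i} → ∅` -/
def uBot (i : Fin 2) : HassePath cs := upsilon (covers_bot cs hM i)

/-- `δ_{S,{i}} : {i} → S` -/
def dTop (i : Fin 2) : HassePath cs := delta (covers_top cs hM i)

/-- `υ_{{i},S} : S → {i}` -/
def uTop (i : Fin 2) : HassePath cs := upsilon (covers_top cs hM i)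

/-- `χ_s = υ_{s} δ_{s}` -/
def chi (s : Fin 2) : HassePath cs := uBot cs hM s * dBot cs hM s

/-- `χ_{[j]t} = ⋯ χ_s χ_t`, the alternating product with `j` factors and last factor `χ_t`,
where `{s, t} = S`; by convention `χ_{[0]t} = e_∅`. -/
def chiAlt (s t : Fin 2) (j : ℕ) : HassePath cs :=
  PathAlgebra.e (vBot cs hM) * ((CoxeterSystem.alternatingWord s t j).map (chi cs hM)).prod

/-- The coefficients `b_j^n`: equal to `C(n-i-1, i) (-q)^i` if `n - j = 2 i` for a natural number
`i`, and equal to zero otherwise (used for `1 ≤ j ≤ n`). -/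
def bCoeff (n j : ℕ) : ℤ[X] :=
  if j ≤ n ∧ Even (n - j) then
    ((n - (n - j) / 2 - 1).choose ((n - j) / 2) : ℤ[X]) * (-X) ^ ((n - j) / 2)
  else 0

/-- The defining relations, for the dihedral group of order `2n`, `n = m_{1,2}`. -/
inductive DihedralRel : HassePath cs → HassePath cs → Prop
  | quasiIdempotentBot (i : Fin 2) : DihedralRel
      (dBot cs hM i * uBot cs hM i)
      ((1 + X : ℤ[X]) • PathAlgebra.e (vMid cs hM i))
  | quasiIdempotentTop (i : Fin 2) : DihedralRel
      (dTop cs hM i * uTop cs hM i)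
      ((∑ k ∈ Finset.range (M 0 1), X ^ k : ℤ[X]) • PathAlgebra.e (vTop cs hM))
  | sandwichUpsilon : DihedralRel
      (uBot cs hM 0 * uTop cs hM 0) (uBot cs hM 1 * uTop cs hM 1)
  | sandwichDelta : DihedralRel
      (dTop cs hM 0 * dBot cs hM 0) (dTop cs hM 1 * dBot cs hM 1)
  | refinedBraidEven (s t : Fin 2) (hst : s ≠ t) (hn : Even (M 0 1)) : DihedralRel
      (uTop cs hM t * dTop cs hM s)
      (dBot cs hM t *
        (∑ j ∈ Finset.Icc 2 (M 0 1), bCoeff (M 0 1) j • chiAlt cs hM s t (j - 2)) *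
        uBot cs hM s)
  | refinedBraidOdd (s t : Fin 2) (hst : s ≠ t) (hn : Odd (M 0 1)) : DihedralRel
      (uTop cs hM s * dTop cs hM s)
      (dBot cs hM s *
        (∑ j ∈ Finset.Icc 3 (M 0 1), bCoeff (M 0 1) j • chiAlt cs hM s t (j - 2)) *
        uBot cs hM s +
        ((-X) ^ ((M 0 1 - 1) / 2) : ℤ[X]) • PathAlgebra.e (vMid cs hM s))

end Dihedral

end HeckeEndo

end

noncomputable section

namespace HeckeEndo

/-! ### Alternating products -/

section AltProd

/-! Write x_i = 1 + T_i, and x_{[k]j} for the alternating product of k such factors with last factor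
x_j. Everything rests on the identity x_S = ∑_k b^n_k x_{[k]j}, valid for both j
(`heckeSum_eq_sum_bCoeff`): partial sums of the T_w obey a three-term recursion, and the b's solve
it by Pascal's rule. Since b^n_n = 1, the identity trades x_{[n]j} for x_S and shorter products. So
1, the x_{[k]j} with 1 ≤ k < n, and x_S span H_q; there are 2n of them, and the regular
representation shows that they form a basis (`heckeBasis`).

This basis is adapted to both multiplications: x_i sends every basis vector into the span of those
basis vectors that it scales by 1 + q. As 1 + q is not a zero divisor, a solution of x_i v = (1 + q)
v involves only such basis vectors, and likewise on the right. An H_q-map from x_I H_q to x_J H_q is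
determined by the image of x_I, which satisfies these equations on the left for i ∈ J and on the
right for i ∈ I. Hence it is a combination of the compatible basis vectors (`repr_entry_eq_zero`).

On the path side, δ_{J,I} acts by x_I ↦ x_J and υ_{I,J} as the inclusion of x_J H_q in x_I H_q. The
relations hold (`pathHom_rel`); the refined braid relations are the expansion of x_S with its outer
factors split off. Conversely, the relations reduce every path to standard elements, indexed in each
block by the basis of H_q (`stdSpan_eq_top`). A compatible standard element sends x_I to its basis
vector (`entry_stdElt_self`), and the others are zero. Sending basis vectors back to standard
elements therefore inverts the homomorphism on both sides. -/

theorem fin_two_add_one_add_one (j : Fin 2) : j + 1 + 1 = j := by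
  revert j; decide

theorem fin_two_eq_add_one {s t : Fin 2} (h : s ≠ t) : s = t + 1 := by
  revert s t; decide

theorem fin_two_add_one_ne (t : Fin 2) : t + 1 ≠ t := by
  revert t; decide

/-- The `k`-th letter from the right (counted from zero) of an alternating word ending in `j`. -/
def lead (j : Fin 2) : ℕ → Fin 2
  | 0 => j
  | k + 1 => lead j k + 1

@[simp] theorem lead_zero (j : Fin 2) : lead j 0 = j := rfl

theorem lead_succ (j : Fin 2) (k : ℕ) : lead j (k + 1) = lead j k + 1 := rfl

theorem lead_add_one (j : Fin 2) (k : ℕ) : lead (j + 1) k = lead j k + 1 := by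
  induction k with
  | zero => rfl
  | succ k ih => rw [lead_succ, lead_succ, ih]

theorem lead_add_two_mul (j : Fin 2) (k r : ℕ) : lead j (k + 2 * r) = lead j k := by
  induction r with
  | zero => rfl
  | succ r ih => rw [show k + 2 * (r + 1) = k + 2 * r + 1 + 1 by ring, lead_succ, lead_succ,
      fin_two_add_one_add_one, ih]

theorem exists_lead_eq (i : Fin 2) (k : ℕ) : ∃ j, lead j k = i := by
  by_cases h : lead i k = i
  · exact ⟨i, h⟩
  · exact ⟨i + 1, by rw [lead_add_one, fin_two_eq_add_one h, fin_two_add_one_add_one]⟩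

/-- The alternating product `⋯ f (j + 1) * f j` with `k` factors and last factor `f j`. -/
def altProd {R : Type*} [Monoid R] (f : Fin 2 → R) (j : Fin 2) : ℕ → R
  | 0 => 1
  | k + 1 => f (lead j k) * altProd f j k

variable {R : Type*} [Monoid R] (f : Fin 2 → R)

@[simp] theorem altProd_zero (j : Fin 2) : altProd f j 0 = 1 := rfl

theorem altProd_succ (j : Fin 2) (k : ℕ) :
    altProd f j (k + 1) = f (lead j k) * altProd f j k := rfl

@[simp] theorem altProd_one (j : Fin 2) : altProd f j 1 = f j := by
  simp [altProd_succ]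

theorem altProd_succ' (j : Fin 2) (k : ℕ) : altProd f j (k + 1) = altProd f (j + 1) k * f j := by
  induction k with
  | zero => simp
  | succ k ih => rw [altProd_succ, ih, altProd_succ, ← mul_assoc, lead_succ, lead_add_one]

theorem prod_map_alternatingWord (j : Fin 2) (k : ℕ) :
    ((CoxeterSystem.alternatingWord (j + 1) j k).map f).prod = altProd f j k := by
  induction k generalizing j with
  | zero => simp [CoxeterSystem.alternatingWord]
  | succ k ih =>
    rw [CoxeterSystem.alternatingWord_succ, altProd_succ', ← ih (j + 1), fin_two_add_one_add_one]
    simp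

theorem map_altProd {S F : Type*} [Monoid S] [FunLike F R S] [MonoidHomClass F R S] (g : F)
    (j : Fin 2) (k : ℕ) : g (altProd f j k) = altProd (fun i => g (f i)) j k := by
  induction k with
  | zero => simp
  | succ k ih => simp [altProd_succ, ih]

end AltProd

/-! ### The coefficients `b_j^n` -/

/-- The boundary case of the recursion in `bCoeff_add_two`, with the missing b^{m+1}_0 read as 0.
For m odd both binomials have the form C(i, i); for m even both sides vanish. -/
theorem bCoeff_add_two_one (m : ℕ) : bCoeff (m + 2) 1 = -X * bCoeff m 1 := by
  by_cases h : Odd m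
  · obtain ⟨k, rfl⟩ := h
    have h1 : 2 * k + 1 + 2 - 1 = 2 * (k + 1) := by omega
    have h2 : 2 * k + 1 - 1 = 2 * k := by omega
    rw [bCoeff, if_pos ⟨by omega, by rw [h1]; simp⟩, bCoeff, if_pos ⟨by omega, by rw [h2]; simp⟩,
      h1, h2]
    have h3 : 2 * k + 1 + 2 - 2 * (k + 1) / 2 - 1 = k + 1 := by omega
    have h4 : 2 * k + 1 - 2 * k / 2 - 1 = k := by omega
    have h5 : 2 * (k + 1) / 2 = k + 1 := by omega
    have h6 : 2 * k / 2 = k := by omega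
    rw [h3, h4, h5, h6]
    simp [pow_succ, mul_comm]
  · rw [bCoeff, if_neg, bCoeff, if_neg, mul_zero]
    · rintro ⟨h1, h2⟩
      rw [Nat.even_sub h1] at h2
      exact h (by simpa using h2)
    · rintro ⟨h1, h2⟩
      rw [Nat.even_sub h1] at h2
      exact h (by simpa [parity_simps] using h2)

/-- Pascal's rule, with the sign and the power of q absorbed by (-q)^i. In the wrong parity all
three coefficients vanish. -/
theorem bCoeff_add_two (m k : ℕ) :
    bCoeff (m + 2) (k + 2) = bCoeff (m + 1) (k + 1) - X * bCoeff m (k + 2) := by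
  by_cases h : k ≤ m ∧ Even (m - k)
  · obtain ⟨hk, i, hi⟩ := h
    obtain rfl : m = k + (i + i) := by omega
    have e1 : k + (i + i) + 2 - (k + 2) = i + i := by omega
    have e2 : k + (i + i) + 1 - (k + 1) = i + i := by omega
    have e3 : (i + i) / 2 = i := by omega
    rw [bCoeff, if_pos ⟨by omega, by rw [e1]; simp⟩, bCoeff, if_pos ⟨by omega, by rw [e2]; simp⟩,
      e1, e2, e3]
    rcases i with _ | i
    · rw [bCoeff, if_neg (by omega)]
      simp
    · have e4 : k + (i + 1 + (i + 1)) - (k + 2) = i + i := by omega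
      have e5 : (i + i) / 2 = i := by omega
      rw [bCoeff, if_pos ⟨by omega, by rw [e4]; simp⟩, e4, e5]
      have e6 : k + (i + 1 + (i + 1)) + 2 - (i + 1) - 1 = (k + i + 1) + 1 := by omega
      have e7 : k + (i + 1 + (i + 1)) + 1 - (i + 1) - 1 = k + i + 1 := by omega
      have e8 : k + (i + 1 + (i + 1)) - i - 1 = k + i + 1 := by omega
      rw [e6, e7, e8, Nat.choose_succ_succ]
      push_cast
      ring
  · have h1 : ¬ (k + 2 ≤ m + 2 ∧ Even (m + 2 - (k + 2))) := by simpa using h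
    have h2 : ¬ (k + 1 ≤ m + 1 ∧ Even (m + 1 - (k + 1))) := by simpa using h
    have h3 : ¬ (k + 2 ≤ m ∧ Even (m - (k + 2))) := by
      rintro ⟨h4, h5⟩
      refine h ⟨by omega, ?_⟩
      rw [show m - k = m - (k + 2) + 2 by omega]
      simpa [parity_simps] using h5
    rw [bCoeff, if_neg h1, bCoeff, if_neg h2, bCoeff, if_neg h3]
    simp

theorem bCoeff_self (m : ℕ) : bCoeff (m + 1) (m + 1) = 1 := by
  simp [bCoeff]

theorem bCoeff_eq_zero_of_lt {m k : ℕ} (h : m < k) : bCoeff m k = 0 := by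
  rw [bCoeff, if_neg (by omega)]

theorem bCoeff_eq_zero_of_not_even {m k : ℕ} (h : ¬ Even (m - k)) : bCoeff m k = 0 := by
  rw [bCoeff, if_neg (by tauto)]

/-! ### Alternating products of elements satisfying the quadratic relation -/

section Quadratic

section

variable {R : Type*} [Ring R] {T : Fin 2 → R}

/-- The partial sum `∑_{k < m} T_{[k]} (1 + T_j)`, which runs over the elements of a dihedral group
in cosets of the `j`-th simple reflection. -/
def cosetSum (T : Fin 2 → R) (j : Fin 2) (m : ℕ) : R :=
  (∑ k ∈ Finset.range m, altProd T (j + 1) k) * (1 + T j)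

theorem cosetSum_succ (j : Fin 2) (m : ℕ) :
    cosetSum T j (m + 1) = cosetSum T j m + altProd T (j + 1) m * (1 + T j) := by
  rw [cosetSum, cosetSum, Finset.sum_range_succ, add_mul]

theorem cosetSum_zero (j : Fin 2) : cosetSum T j 0 = 0 := by simp [cosetSum]

/-- In `cosetSum T j m` the words ending in j have length at most m and those ending in j + 1 have
length below m. Exchanging the two letters and raising m by one extends only the second family, by
two words. -/
theorem cosetSum_add_one_succ (j : Fin 2) (m : ℕ) :
    cosetSum T (j + 1) (m + 1) =
      cosetSum T j m + altProd T (j + 1) m + altProd T (j + 1) (m + 1) := by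
  induction m with
  | zero => simp [cosetSum_succ, cosetSum_zero]
  | succ m ih =>
    rw [cosetSum_succ, ih, fin_two_add_one_add_one, cosetSum_succ (m := m),
      mul_add, mul_add, altProd_succ' T (j + 1) (m + 1), ← altProd_succ',
      fin_two_add_one_add_one, mul_one, mul_one]
    abel

/-- At length n the braid relation kills the right-hand side, so both coset enumerations give the
same x_S. -/
theorem cosetSum_sub (j : Fin 2) (m : ℕ) :
    cosetSum T (j + 1) (m + 1) - cosetSum T j (m + 1) =
      altProd T (j + 1) (m + 1) - altProd T j (m + 1) := by
  rw [cosetSum_add_one_succ, cosetSum_succ, mul_add, ← altProd_succ', mul_one]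
  abel

theorem sum_altProd_add (j : Fin 2) (m : ℕ) :
    cosetSum T j m = ∑ k ∈ Finset.range m, (altProd T (j + 1) k + altProd T j (k + 1)) := by
  rw [cosetSum, Finset.sum_mul]
  refine Finset.sum_congr rfl fun k _ => ?_
  rw [mul_add, mul_one, altProd_succ']

end

variable {R : Type*} [Ring R] [Algebra ℤ[X] R] {T : Fin 2 → R}

variable (hT : ∀ i, T i * T i = ((X : ℤ[X]) - 1) • T i + algebraMap ℤ[X] R X)

include hT

theorem one_add_mul_self (i : Fin 2) : (1 + T i) * (1 + T i) = (1 + X : ℤ[X]) • (1 + T i) := by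
  rw [mul_add, add_mul, add_mul, hT, Algebra.algebraMap_eq_smul_one]
  simp only [sub_smul, add_smul, smul_add, one_smul, mul_one, one_mul]
  abel

theorem cosetSum_mul (j : Fin 2) (m : ℕ) :
    cosetSum T j m * (1 + T j) = (1 + X : ℤ[X]) • cosetSum T j m := by
  rw [cosetSum, mul_assoc, one_add_mul_self hT, mul_smul_comm]

/-- The three-term recursion behind the b's: multiply `cosetSum_add_one_succ` by 1 + T_j. The old
sum is scaled by 1 + q, and its copy with factor 1 is completed by the two new terms. -/
theorem cosetSum_add_two (j : Fin 2) (m : ℕ) :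
    cosetSum T j (m + 2) =
      cosetSum T (j + 1) (m + 1) * (1 + T j) - (X : ℤ[X]) • cosetSum T j m := by
  rw [cosetSum_add_one_succ, add_mul, add_mul, cosetSum_mul hT, cosetSum_succ, cosetSum_succ,
    add_smul, one_smul]
  abel

/-- Right multiplication by 1 + T_j lengthens an alternating product by one factor, so
`cosetSum_add_two` becomes the recursion of the coefficients. Only the quadratic relation enters,
and no braid relation. -/
theorem cosetSum_eq_sum_bCoeff (j : Fin 2) (m : ℕ) :
    cosetSum T j m =
      ∑ k ∈ Finset.range m, bCoeff m (k + 1) • altProd (fun i => 1 + T i) j (k + 1) := by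
  induction m using Nat.strong_induction_on generalizing j with
  | _ m ih =>
    rcases m with _ | _ | m
    · simp [cosetSum_zero]
    · simp [cosetSum_succ, cosetSum_zero, bCoeff_self]
    · rw [cosetSum_add_two hT, ih (m + 1) (by omega), ih m (by omega), Finset.sum_mul,
        Finset.sum_range_succ' _ (m + 1), bCoeff_add_two_one]
      have h1 : ∀ k, bCoeff (m + 1) (k + 1) • altProd (fun i => 1 + T i) (j + 1) (k + 1) *
          (1 + T j) = bCoeff (m + 1) (k + 1) • altProd (fun i => 1 + T i) j (k + 2) := by
        intro k
        rw [smul_mul_assoc, altProd_succ' _ j (k + 1)]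
      -- The index shift creates terms with coefficients b^m_{m+1} and b^m_{m+2}, which are zero.
      have h2 : ∑ k ∈ Finset.range m, bCoeff m (k + 1) • altProd (fun i => 1 + T i) j (k + 1) =
          ∑ k ∈ Finset.range (m + 1), bCoeff m (k + 2) • altProd (fun i => 1 + T i) j (k + 2) +
            bCoeff m 1 • altProd (fun i => 1 + T i) j 1 := by
        rw [← Finset.sum_range_succ'
          (fun k => bCoeff m (k + 1) • altProd (fun i => 1 + T i) j (k + 1)),
          Finset.sum_range_succ, Finset.sum_range_succ, bCoeff_eq_zero_of_lt (by omega),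
          bCoeff_eq_zero_of_lt (by omega)]
        simp
      rw [h2]
      simp only [h1, bCoeff_add_two, sub_smul, Finset.sum_sub_distrib, mul_smul, neg_mul, neg_smul,
        smul_add, Finset.smul_sum]
      abel

theorem lead_mul_altProd_one_add (j : Fin 2) (k : ℕ) :
    (1 + T (lead j k)) * altProd (fun i => 1 + T i) j (k + 1) =
      (1 + X : ℤ[X]) • altProd (fun i => 1 + T i) j (k + 1) := by
  rw [altProd_succ, ← mul_assoc, one_add_mul_self hT, smul_mul_assoc]

theorem altProd_one_add_mul_last (j : Fin 2) (k : ℕ) :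
    altProd (fun i => 1 + T i) j (k + 1) * (1 + T j) =
      (1 + X : ℤ[X]) • altProd (fun i => 1 + T i) j (k + 1) := by
  rw [altProd_succ', mul_assoc, one_add_mul_self hT, mul_smul_comm]

/-- Products with nonzero coefficient have length of the same parity as m + 1, hence the same first
letter. -/
theorem lead_mul_cosetSum (j : Fin 2) (m : ℕ) :
    (1 + T (lead j m)) * cosetSum T j (m + 1) = (1 + X : ℤ[X]) • cosetSum T j (m + 1) := by
  rw [cosetSum_eq_sum_bCoeff hT, Finset.mul_sum, Finset.smul_sum]
  refine Finset.sum_congr rfl fun k hk => ?_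
  by_cases h : Even (m + 1 - (k + 1))
  · have hkm : k ≤ m := by simpa [Nat.lt_succ_iff] using hk
    have : lead j m = lead j k := by
      obtain ⟨r, hr⟩ := h
      obtain rfl : m = k + 2 * r := by omega
      rw [lead_add_two_mul]
    rw [this, mul_smul_comm, lead_mul_altProd_one_add hT, smul_comm]
  · rw [bCoeff_eq_zero_of_not_even h]
    simp

/-- If the two alternating products of length `m + 1` agree on a vector,
then they agree on its images under the generators. -/
theorem altProd_smul_eq_of_eq {V : Type*} [AddCommGroup V] [Module R V] {m : ℕ} {v : V} (j : Fin 2)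
    (hv : altProd T j (m + 1) • v = altProd T (j + 1) (m + 1) • v) :
    altProd T j (m + 1) • T j • v = altProd T (j + 1) (m + 1) • T j • v := by
  have h1 : altProd T j (m + 1) * T j = ((X : ℤ[X]) - 1) • altProd T j (m + 1) +
      (X : ℤ[X]) • altProd T (j + 1) m := by
    rw [altProd_succ', mul_assoc, hT, mul_add, mul_smul_comm, Algebra.algebraMap_eq_smul_one,
      mul_smul_comm, mul_one]
  -- Both sides equal the alternating product of length m + 2. On the right the hypothesis on v can
  -- be applied to switch the last letter, after which the quadratic relation at the front leaves
  -- the same remainder of length m as in `h1`.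
  have h2 : altProd T (j + 1) (m + 1) * T j = T (lead j (m + 1)) * altProd T j (m + 1) := by
    rw [← altProd_succ, ← altProd_succ']
  have h3 : T (lead j (m + 1)) * altProd T (j + 1) (m + 1) =
      ((X : ℤ[X]) - 1) • altProd T (j + 1) (m + 1) + (X : ℤ[X]) • altProd T (j + 1) m := by
    rw [altProd_succ]
    rw [lead_succ, ← lead_add_one, ← mul_assoc, hT, add_mul, smul_mul_assoc,
      Algebra.algebraMap_eq_smul_one,
      smul_mul_assoc, one_mul]
  have h4 : (((X : ℤ[X]) - 1) • altProd T j (m + 1)) • v =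
      (((X : ℤ[X]) - 1) • altProd T (j + 1) (m + 1)) • v := by
    rw [Algebra.smul_def, Algebra.smul_def, mul_smul, mul_smul, hv]
  rw [← mul_smul, ← mul_smul, h1, h2, add_smul, mul_smul (T _), hv, ← mul_smul, h3, add_smul, h4]

end Quadratic

/-! ### Finite dihedral groups -/

section DihedralGroup

variable {W : Type*} [Group W] {M : CoxeterMatrix (Fin 2)} (cs : CoxeterSystem M W)
  (hM : M 0 1 ≠ 0)

theorem matrix_apply_add_one (M : CoxeterMatrix (Fin 2)) (j : Fin 2) : M (j + 1) j = M 0 1 := by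
  fin_cases j
  · exact M.symmetric 1 0
  · rfl

include hM in
theorem two_le_matrix_apply : 2 ≤ M 0 1 := by
  have := M.off_diagonal 0 1 (by decide)
  omega

include cs hM in
-- The two generating reflections of the concrete dihedral group satisfy the Coxeter relations, so W
-- surjects onto it. Counting alternating words only bounds the order from above.
theorem two_mul_le_card : 2 * M 0 1 ≤ Nat.card W := by
  have : NeZero (M 0 1) := ⟨hM⟩
  have := finite_of_dihedral cs hM
  let f : Fin 2 → DihedralGroup (M 0 1) := ![.sr 0, .sr 1]
  have hf : M.IsLiftable f := by
    intro i i'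
    fin_cases i <;> fin_cases i'
    · simp [f, DihedralGroup.sr_mul_sr]
    · simp [f, DihedralGroup.sr_mul_sr]
    · have : M 1 0 = M 0 1 := M.symmetric 1 0
      simp [f, DihedralGroup.sr_mul_sr, this]
    · simp [f, DihedralGroup.sr_mul_sr]
  let φ : W →* DihedralGroup (M 0 1) := cs.lift ⟨f, hf⟩
  have h0 : φ (cs.simple 0) = .sr 0 := cs.lift_apply_simple hf 0
  have h1 : φ (cs.simple 1) = .sr 1 := cs.lift_apply_simple hf 1
  have hk (k : ZMod (M 0 1)) : φ ((cs.simple 0 * cs.simple 1) ^ k.val) = .r k := by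
    rw [map_pow, map_mul, h0, h1, DihedralGroup.sr_mul_sr, sub_zero, DihedralGroup.r_one_pow]
    simp
  have hφ : Function.Surjective φ := by
    rintro (k | k)
    · exact ⟨_, hk k⟩
    · exact ⟨cs.simple 0 * (cs.simple 0 * cs.simple 1) ^ k.val, by
        rw [map_mul, h0, hk k, DihedralGroup.sr_mul_r, zero_add]⟩
  calc 2 * M 0 1 = Nat.card (DihedralGroup (M 0 1)) := DihedralGroup.nat_card.symm
    _ ≤ Nat.card W := Nat.card_le_card_of_surjective φ hφ

theorem wordProd_alternatingWord (j : Fin 2) (k : ℕ) :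
    cs.wordProd (CoxeterSystem.alternatingWord (j + 1) j k) = altProd cs.simple j k :=
  prod_map_alternatingWord cs.simple j k

theorem altProd_simple_braid (j : Fin 2) :
    altProd cs.simple j (M 0 1) = altProd cs.simple (j + 1) (M 0 1) := by
  have h := cs.wordProd_braidWord_eq (j + 1) j
  rw [CoxeterSystem.braidWord, CoxeterSystem.braidWord, M.symmetric j (j + 1),
    matrix_apply_add_one, wordProd_alternatingWord] at h
  rw [h, ← wordProd_alternatingWord, fin_two_add_one_add_one]

include hM in
-- A new letter in front of an alternating word cancels its first letter or lengthens it. At length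
-- n the braid relation switches the first letter, so that cancellation always occurs. The bound by
-- the length of ω serves to compute Coxeter lengths.
theorem exists_altProd_eq_wordProd (ω : List (Fin 2)) :
    ∃ j k, k ≤ M 0 1 ∧ k ≤ ω.length ∧ cs.wordProd ω = altProd cs.simple j k := by
  induction ω with
  | nil => exact ⟨0, 0, by simp, by simp, by simp⟩
  | cons i ω ih =>
    obtain ⟨j, k, h1, h2, h3⟩ := ih
    have key : ∀ j' k', k = k' + 1 → lead j' k' = i → altProd cs.simple j k =
        altProd cs.simple j' k → ∃ j k, k ≤ M 0 1 ∧ k ≤ (i :: ω).length ∧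
          cs.wordProd (i :: ω) = altProd cs.simple j k := by
      rintro j' k' rfl hl he
      refine ⟨j', k', by omega, by simp; omega, ?_⟩
      rw [cs.wordProd_cons, h3, he, altProd_succ, hl, cs.simple_mul_simple_cancel_left]
    rcases k with _ | k
    · exact ⟨i, 1, by omega, by simp, by simp [cs.wordProd_cons, h3]⟩
    · by_cases hl : lead j k = i
      · exact key j k rfl hl rfl
      · have hi : i = lead j k + 1 := fin_two_eq_add_one (Ne.symm hl)
        by_cases hk : k + 1 < M 0 1
        · refine ⟨j, k + 2, by omega, by simpa using h2, ?_⟩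
          rw [cs.wordProd_cons, h3, altProd_succ _ _ (k + 1), lead_succ, hi]
        · have hk' : k + 1 = M 0 1 := by omega
          refine key (j + 1) k rfl (by rw [lead_add_one, hi]) ?_
          rw [hk', altProd_simple_braid]

/-- The elements of the dihedral group, in left cosets of the `j`-th simple reflection. -/
def dihedralElt (j : Fin 2) : Fin (M 0 1) ⊕ Fin (M 0 1) → W :=
  Sum.elim (fun k => altProd cs.simple (j + 1) k) (fun k => altProd cs.simple j (k + 1))

include hM in
theorem dihedralElt_surjective (j : Fin 2) : Function.Surjective (dihedralElt cs j) := by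
  intro w
  obtain ⟨ω, rfl⟩ := cs.wordProd_surjective w
  obtain ⟨j', k, hk, -, h⟩ := exists_altProd_eq_wordProd cs hM ω
  rw [h]
  have key : ∀ k, k ≤ M 0 1 → ∃ a, dihedralElt cs j a = altProd cs.simple j k := by
    rintro (_ | k) hk
    · exact ⟨.inl ⟨0, by omega⟩, rfl⟩
    · exact ⟨.inr ⟨k, by omega⟩, rfl⟩
  by_cases hj : j' = j
  · subst hj
    exact key k hk
  · obtain rfl := fin_two_eq_add_one hj
    -- The labels for j contain words ending in j + 1 only below length n; the longest word is
    -- rewritten to end in j.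
    by_cases hk' : k < M 0 1
    · exact ⟨.inl ⟨k, hk'⟩, rfl⟩
    · obtain rfl : k = M 0 1 := by omega
      rw [← altProd_simple_braid]
      exact key _ le_rfl

include hM in
theorem dihedralElt_bijective (j : Fin 2) : Function.Bijective (dihedralElt cs j) := by
  have := finite_of_dihedral cs hM
  have := Fintype.ofFinite W
  refine (Fintype.bijective_iff_surjective_and_card _).2 ⟨dihedralElt_surjective cs hM j, ?_⟩
  refine le_antisymm ?_ (Fintype.card_le_of_surjective _ (dihedralElt_surjective cs hM j))
  have := two_mul_le_card cs hM
  rw [Nat.card_eq_fintype_card] at this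
  simpa [two_mul] using this

include cs hM in
theorem card_dihedral : Nat.card W = 2 * M 0 1 := by
  rw [← Nat.card_eq_of_bijective _ (dihedralElt_bijective cs hM 0)]
  simp [two_mul]

include hM in
theorem altProd_simple_injective {j j' : Fin 2} {k k' : ℕ} (hk : k ≤ M 0 1) (hk' : k' ≤ M 0 1)
    (h : altProd cs.simple j k = altProd cs.simple j' k') : k = k' := by
  have key : ∀ k, k ≤ M 0 1 → ∃ a, dihedralElt cs j a = altProd cs.simple j k ∧
      Sum.elim (fun k : Fin (M 0 1) => (k : ℕ)) (fun k : Fin (M 0 1) => (k : ℕ) + 1) a = k := by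
    rintro (_ | k) hk
    · exact ⟨.inl ⟨0, by omega⟩, rfl, rfl⟩
    · exact ⟨.inr ⟨k, by omega⟩, rfl, rfl⟩
  have inj := (dihedralElt_bijective cs hM j).1
  have same : ∀ k', k' ≤ M 0 1 → altProd cs.simple j k = altProd cs.simple j k' → k = k' := by
    intro k' hk' h
    obtain ⟨a, h1, h2⟩ := key k hk
    obtain ⟨a', h1', h2'⟩ := key k' hk'
    rw [← h2, ← h2', inj (h1.trans (h.trans h1'.symm))]
  by_cases hj : j' = j
  · subst hj
    exact same k' hk' h
  · obtain rfl := fin_two_eq_add_one hj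
    by_cases hk'' : k' < M 0 1
    · obtain ⟨a, h1, h2⟩ := key k hk
      have ha : a = .inl ⟨k', hk''⟩ := inj (h1.trans h)
      subst ha
      exact h2.symm
    · obtain rfl : k' = M 0 1 := by omega
      exact same _ le_rfl (by rw [h, ← altProd_simple_braid])

include hM in
-- A reduced word of the element has an alternating form no longer than itself, and the length of an
-- alternating form is determined by the element.
theorem length_altProd_simple (j : Fin 2) {k : ℕ} (hk : k ≤ M 0 1) :
    cs.length (altProd cs.simple j k) = k := by
  obtain ⟨ω, hω, h⟩ := cs.exists_isReduced (altProd cs.simple j k)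
  obtain ⟨j', k', h1, h2, h3⟩ := exists_altProd_eq_wordProd cs hM ω
  obtain rfl := altProd_simple_injective cs hM hk h1 (h.trans h3)
  refine le_antisymm ?_ ?_
  · simpa [wordProd_alternatingWord] using
      cs.length_wordProd_le (CoxeterSystem.alternatingWord (j + 1) j k)
  · rw [h, hω.eq]
    exact h2

end DihedralGroup

/-! ### The regular representation -/

section RegularRep

variable {B W : Type*} [Group W] {M : CoxeterMatrix B} (cs : CoxeterSystem M W)

open Classical in
/-- The action of `T_s` on the free module with basis `W`. -/
def regularGen (s : B) : Module.End ℤ[X] (W →₀ ℤ[X]) :=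
  Finsupp.linearCombination ℤ[X] fun w =>
    if cs.IsLeftDescent w s then
      ((X : ℤ[X]) - 1) • Finsupp.single w 1 + (X : ℤ[X]) • Finsupp.single (cs.simple s * w) 1
    else Finsupp.single (cs.simple s * w) 1

variable {cs} in
theorem regularGen_single_of_not {s : B} {w : W} (h : ¬ cs.IsLeftDescent w s) :
    regularGen cs s (Finsupp.single w 1) = Finsupp.single (cs.simple s * w) 1 := by
  simp [regularGen, h]

variable {cs} in
theorem regularGen_single {s : B} {w : W} (h : cs.IsLeftDescent w s) :
    regularGen cs s (Finsupp.single w 1) =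
      ((X : ℤ[X]) - 1) • Finsupp.single w 1 + (X : ℤ[X]) • Finsupp.single (cs.simple s * w) 1 := by
  simp [regularGen, h]

theorem regularGen_mul_self (s : B) : regularGen cs s * regularGen cs s =
    ((X : ℤ[X]) - 1) • regularGen cs s + algebraMap ℤ[X] _ X := by
  refine Finsupp.lhom_ext' fun w => LinearMap.ext_ring ?_
  have h1 : ∀ {w}, ¬ cs.IsLeftDescent w s → cs.IsLeftDescent (cs.simple s * w) s := by
    intro w h
    rw [cs.isLeftDescent_iff_not_isLeftDescent_mul] at h
    exact not_not.1 h
  change regularGen cs s (regularGen cs s (Finsupp.single w 1)) =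
    ((X : ℤ[X]) - 1) • regularGen cs s (Finsupp.single w 1) + (X : ℤ[X]) • Finsupp.single w 1
  by_cases h : cs.IsLeftDescent w s
  · have h2 : ¬ cs.IsLeftDescent (cs.simple s * w) s :=
      (cs.isLeftDescent_iff_not_isLeftDescent_mul).1 h
    rw [regularGen_single h, map_add, map_smul, map_smul, regularGen_single h,
      regularGen_single_of_not h2, cs.simple_mul_simple_cancel_left]
  · rw [regularGen_single_of_not h, regularGen_single (h1 h), cs.simple_mul_simple_cancel_left]

theorem prod_regularGen_single_one {ω : List B} (h : cs.IsReduced ω) :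
    (ω.map (regularGen cs)).prod (Finsupp.single 1 1) = Finsupp.single (cs.wordProd ω) 1 := by
  induction ω with
  | nil => simp
  | cons i ω ih =>
    have h' : cs.IsReduced ω := h.drop 1
    have hd : ¬ cs.IsLeftDescent (cs.wordProd ω) i := by
      have e1 := h.eq
      rw [cs.wordProd_cons] at e1
      rw [CoxeterSystem.IsLeftDescent, e1, h'.eq]
      simp
    rw [List.map_cons, List.prod_cons, Module.End.mul_apply, ih h', regularGen_single_of_not hd,
      cs.wordProd_cons]

end RegularRep

/-! ### Braid relations in the regular representation of a finite dihedral group -/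

section DihedralRep

variable {W : Type*} [Group W] {M : CoxeterMatrix (Fin 2)} (cs : CoxeterSystem M W)
  (hM : M 0 1 ≠ 0)

include hM in
theorem isReduced_alternatingWord (j : Fin 2) {k : ℕ} (hk : k ≤ M 0 1) :
    cs.IsReduced (CoxeterSystem.alternatingWord (j + 1) j k) := by
  rw [CoxeterSystem.IsReduced, wordProd_alternatingWord, length_altProd_simple cs hM j hk,
    CoxeterSystem.length_alternatingWord]

include hM in
theorem altProd_regularGen_single_one (j : Fin 2) {k : ℕ} (hk : k ≤ M 0 1) :
    altProd (regularGen cs) j k (Finsupp.single 1 1) =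
      Finsupp.single (altProd cs.simple j k) 1 := by
  rw [← prod_map_alternatingWord,
    prod_regularGen_single_one cs (isReduced_alternatingWord cs hM j hk),
    wordProd_alternatingWord]

include hM in
-- On the basis vector of the identity this is the braid relation in W, because the words are
-- reduced. `altProd_smul_eq_of_eq` carries it along generators, and reduced words reach every basis
-- vector.
theorem altProd_regularGen_braid (j : Fin 2) :
    altProd (regularGen cs) j (M 0 1) = altProd (regularGen cs) (j + 1) (M 0 1) := by
  refine Finsupp.lhom_ext' fun w => LinearMap.ext_ring ?_
  change altProd (regularGen cs) j (M 0 1) (Finsupp.single w 1) =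
    altProd (regularGen cs) (j + 1) (M 0 1) (Finsupp.single w 1)
  obtain ⟨ω, hω, rfl⟩ := cs.exists_isReduced w
  rw [← prod_regularGen_single_one cs hω]
  clear hω
  induction ω with
  | nil =>
    simp only [List.map_nil, List.prod_nil, Module.End.one_apply]
    rw [altProd_regularGen_single_one cs hM j le_rfl, altProd_regularGen_single_one cs hM _ le_rfl,
      altProd_simple_braid]
  | cons i ω ih =>
    obtain ⟨m, hm⟩ : ∃ m, M 0 1 = m + 1 := ⟨M 0 1 - 1, by omega⟩
    rw [hm] at ih ⊢
    by_cases hi : i = j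
    · subst hi
      exact altProd_smul_eq_of_eq (T := regularGen cs) (V := W →₀ ℤ[X])
        (regularGen_mul_self cs) i ih
    · obtain rfl := fin_two_eq_add_one hi
      have := altProd_smul_eq_of_eq (T := regularGen cs) (V := W →₀ ℤ[X]) (m := m)
        (v := (ω.map (regularGen cs)).prod (Finsupp.single 1 1)) (regularGen_mul_self cs) (j + 1)
        (by rw [fin_two_add_one_add_one]; exact ih.symm)
      rw [fin_two_add_one_add_one] at this
      exact this.symm

/-- The representation of the Hecke algebra on the free module with basis `W`. -/
def regularRep : Hecke M →ₐ[ℤ[X]] Module.End ℤ[X] (W →₀ ℤ[X]) :=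
  RingQuot.liftAlgHom ℤ[X] ⟨FreeAlgebra.lift ℤ[X] (regularGen cs), by
    intro a b h
    cases h with
    | quadratic s => simpa using regularGen_mul_self cs s
    | braid s t hst hm =>
      obtain rfl := fin_two_eq_add_one hst
      rw [matrix_apply_add_one] at hm ⊢
      rw [map_list_prod, map_list_prod, List.map_map, List.map_map]
      have hc : ⇑(FreeAlgebra.lift ℤ[X] (regularGen cs)) ∘ FreeAlgebra.ι ℤ[X] = regularGen cs :=
        FreeAlgebra.ι_comp_lift _
      have h1 := prod_map_alternatingWord (regularGen cs) (t + 1) (M 0 1)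
      rw [fin_two_add_one_add_one] at h1
      rw [hc, prod_map_alternatingWord, h1, altProd_regularGen_braid cs hm]⟩

theorem regularRep_gen (s : Fin 2) : regularRep cs (Hecke.gen M s) = regularGen cs s := by
  simp [regularRep, Hecke.gen]

/-- The value does not depend on the reduced word chosen in `heckeT`, so identities for x_I can be
checked here without Matsumoto's theorem. -/
theorem regularRep_heckeT (w : W) :
    regularRep cs (heckeT cs w) (Finsupp.single 1 1) = Finsupp.single w 1 := by
  obtain ⟨h1, h2⟩ := (exists_reduced cs w).choose_spec
  rw [heckeT, map_list_prod, List.map_map,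
    show ⇑(regularRep cs) ∘ Hecke.gen M = regularGen cs from funext (regularRep_gen cs),
    prod_regularGen_single_one cs h1, h2]

theorem regularRep_altProd (j : Fin 2) {k : ℕ} (hk : k ≤ M 0 1) :
    regularRep cs (altProd (Hecke.gen M) j k) (Finsupp.single 1 1) =
      Finsupp.single (altProd cs.simple j k) 1 := by
  by_cases hM : M 0 1 = 0
  · obtain rfl : k = 0 := by omega
    simp
  · rw [map_altProd, ← altProd_regularGen_single_one cs hM j hk]
    simp only [regularRep_gen]

end DihedralRep

/-! ### A basis of the Hecke algebra of a finite dihedral group -/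

section HeckeBasis

variable {W : Type*} [Group W] {M : CoxeterMatrix (Fin 2)} (cs : CoxeterSystem M W)
  (hM : M 0 1 ≠ 0)

theorem gen_mul_self (M : CoxeterMatrix (Fin 2)) (i : Fin 2) : Hecke.gen M i * Hecke.gen M i =
    ((X : ℤ[X]) - 1) • Hecke.gen M i + algebraMap ℤ[X] _ X := by
  have := RingQuot.mkAlgHom_rel ℤ[X] (HeckeRel.quadratic (M := M) i)
  simpa [Hecke.gen] using this

include hM in
theorem altProd_gen_braid (j : Fin 2) :
    altProd (Hecke.gen M) j (M 0 1) = altProd (Hecke.gen M) (j + 1) (M 0 1) := by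
  have h := RingQuot.mkAlgHom_rel ℤ[X] (HeckeRel.braid (M := M) (j + 1) j (fin_two_add_one_ne j)
    (by rwa [matrix_apply_add_one]))
  have h1 := prod_map_alternatingWord (FreeAlgebra.ι ℤ[X]) (j + 1) (M 0 1)
  rw [fin_two_add_one_add_one] at h1
  rw [matrix_apply_add_one, prod_map_alternatingWord, h1, map_altProd, map_altProd] at h
  exact h

/-- The elements 1 + T_i generate the algebra as well as the T_i do. -/
theorem hecke_induction {M : CoxeterMatrix (Fin 2)} {p : Submodule ℤ[X] (Hecke M)}
    (one : 1 ∈ p) (mul : ∀ i, ∀ x ∈ p, (1 + Hecke.gen M i) * x ∈ p) (h : Hecke M) : h ∈ p := by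
  obtain ⟨a, rfl⟩ := RingQuot.mkAlgHom_surjective ℤ[X] (HeckeRel M) h
  suffices H : ∀ x ∈ p, RingQuot.mkAlgHom ℤ[X] (HeckeRel M) a * x ∈ p by simpa using H 1 one
  induction a using FreeAlgebra.induction with
  | grade0 r =>
    intro x hx
    rw [AlgHom.commutes, ← Algebra.smul_def]
    exact p.smul_mem r hx
  | grade1 i =>
    intro x hx
    have := Submodule.sub_mem (R := ℤ[X]) (M := Hecke M) p (mul i x hx) hx
    have h : (1 + Hecke.gen M i) * x - x = Hecke.gen M i * x := by
      rw [add_mul, one_mul]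
      exact add_sub_cancel_left (G := Hecke M) _ _
    rwa [h] at this
  | mul a b ha hb =>
    intro x hx
    rw [map_mul, mul_assoc]
    exact ha _ (hb x hx)
  | add a b ha hb =>
    intro x hx
    rw [map_add, add_mul]
    exact p.add_mem (ha x hx) (hb x hx)

/-- The element `x_{{i}} = 1 + T_i`. -/
abbrev genX (M : CoxeterMatrix (Fin 2)) (i : Fin 2) : Hecke M := 1 + Hecke.gen M i

/-- The sum of the `T_w` over all elements `w` of the dihedral group. -/
def heckeSum (M : CoxeterMatrix (Fin 2)) : Hecke M := cosetSum (Hecke.gen M) 0 (M 0 1)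

include hM in
theorem cosetSum_eq_heckeSum (j : Fin 2) :
    cosetSum (Hecke.gen M) j (M 0 1) = heckeSum M := by
  obtain ⟨m, hm⟩ : ∃ m, M 0 1 = m + 1 := ⟨M 0 1 - 1, by omega⟩
  have h := cosetSum_sub (T := Hecke.gen M) 0 m
  rw [← hm, ← altProd_gen_braid hM, sub_self, sub_eq_zero] at h
  fin_cases j
  · rfl
  · exact h

include hM in
theorem heckeSum_eq_sum_bCoeff (j : Fin 2) : heckeSum M =
    ∑ k ∈ Finset.range (M 0 1), bCoeff (M 0 1) (k + 1) • altProd (genX M) j (k + 1) := by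
  rw [← cosetSum_eq_heckeSum hM j, cosetSum_eq_sum_bCoeff (gen_mul_self M)]

include hM in
theorem heckeSum_mul_genX (j : Fin 2) : heckeSum M * genX M j = (1 + X : ℤ[X]) • heckeSum M := by
  rw [← cosetSum_eq_heckeSum hM j, cosetSum_mul (gen_mul_self M)]

include hM in
theorem genX_mul_heckeSum (i : Fin 2) : genX M i * heckeSum M = (1 + X : ℤ[X]) • heckeSum M := by
  obtain ⟨m, hm⟩ : ∃ m, M 0 1 = m + 1 := ⟨M 0 1 - 1, by omega⟩
  obtain ⟨j, rfl⟩ := exists_lead_eq i m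
  rw [← cosetSum_eq_heckeSum hM j, hm]
  exact lead_mul_cosetSum (R := Hecke M) (gen_mul_self M) j m

/-- The labels of the basis `1`, `x_{[k]j}` for `1 ≤ k < n`, and `x_S` of the Hecke algebra:
`none` stands for `1`, `some none` for `x_S`, and `some (some (j, k))` for `x_{[k + 1]j}`. -/
abbrev BasisIdx (M : CoxeterMatrix (Fin 2)) := Option (Option (Fin 2 × Fin (M 0 1 - 1)))

/-- The elements `1`, `x_{[k]j}` for `1 ≤ k < n`, and `x_S` of the Hecke algebra. -/
def basisVec (M : CoxeterMatrix (Fin 2)) : BasisIdx M → Hecke M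
  | none => 1
  | some none => heckeSum M
  | some (some (j, k)) => altProd (genX M) j (k + 1)

theorem basisVec_mem_span {P : BasisIdx M → Prop} {β : BasisIdx M} (h : P β) :
    basisVec M β ∈ Submodule.span ℤ[X] (basisVec M '' {β | P β}) :=
  Submodule.subset_span (Set.mem_image_of_mem _ h)

/-- The basis elements that are multiplied by `1 + q` under left multiplication by `x_i`. -/
def BasisIdx.Starts (i : Fin 2) : BasisIdx M → Prop
  | none => False
  | some none => True
  | some (some (j, k)) => lead j k = i

/-- The basis elements that are multiplied by `1 + q` under right multiplication by `x_i`. -/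
def BasisIdx.Ends (i : Fin 2) : BasisIdx M → Prop
  | none => False
  | some none => True
  | some (some (j, _)) => j = i

theorem genX_mul_basisVec_of_starts (hM : M 0 1 ≠ 0) {i : Fin 2} {β : BasisIdx M}
    (h : β.Starts i) : genX M i * basisVec M β = (1 + X : ℤ[X]) • basisVec M β := by
  rcases β with _ | _ | ⟨j, k⟩
  · exact h.elim
  · exact genX_mul_heckeSum hM i
  · obtain rfl : lead j k = i := h
    exact lead_mul_altProd_one_add (R := Hecke M) (gen_mul_self M) j k

theorem basisVec_mul_genX_of_ends (hM : M 0 1 ≠ 0) {i : Fin 2} {β : BasisIdx M}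
    (h : β.Ends i) : basisVec M β * genX M i = (1 + X : ℤ[X]) • basisVec M β := by
  rcases β with _ | _ | ⟨j, k⟩
  · exact h.elim
  · exact heckeSum_mul_genX hM i
  · obtain rfl : j = i := h
    exact altProd_one_add_mul_last (R := Hecke M) (gen_mul_self M) j k

theorem lead_eq_of_even_sub (j : Fin 2) {m k : ℕ} (hk : k ≤ m) (h : Even (m + 1 - (k + 1))) :
    lead j m = lead j k := by
  obtain ⟨r, hr⟩ := h
  obtain rfl : m = k + 2 * r := by omega
  rw [lead_add_two_mul]

include hM in
-- Only length n needs an argument: there the product is x_S minus shorter products with the same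
-- last letter and, by parity, the same first letter.
theorem altProd_genX_mem_span (j : Fin 2) {k : ℕ} (hk : k < M 0 1) :
    altProd (genX M) j (k + 1) ∈
      Submodule.span ℤ[X] (basisVec M '' {β | β.Starts (lead j k) ∧ β.Ends j}) := by
  by_cases hk' : k < M 0 1 - 1
  · exact basisVec_mem_span (β := some (some (j, ⟨k, hk'⟩))) ⟨rfl, rfl⟩
  · have hm : M 0 1 = k + 1 := by omega
    have h := heckeSum_eq_sum_bCoeff hM j
    rw [hm, Finset.sum_range_succ, bCoeff_self, one_smul] at h
    rw [← (sub_eq_iff_eq_add' (G := Hecke M)).2 h]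
    refine Submodule.sub_mem (R := ℤ[X]) (M := Hecke M) _
      (basisVec_mem_span (β := some none) ⟨trivial, trivial⟩)
      (Submodule.sum_mem _ fun l hl => ?_)
    have hl' : l < k := Finset.mem_range.1 hl
    by_cases he : Even (k + 1 - (l + 1))
    · refine Submodule.smul_mem _ _ (basisVec_mem_span
        (β := some (some (j, ⟨l, by omega⟩))) ⟨(lead_eq_of_even_sub j hl'.le he).symm, rfl⟩)
    · rw [bCoeff_eq_zero_of_not_even he, zero_smul]
      exact Submodule.zero_mem _

include hM in
-- If x_i does not scale the vector, it lengthens the alternating product, to length at most n. This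
-- holds for all basis vectors, which is what isolates the eigenvectors later.
theorem genX_mul_basisVec_mem (i : Fin 2) (β : BasisIdx M) :
    genX M i * basisVec M β ∈ Submodule.span ℤ[X] (basisVec M '' {β | β.Starts i}) := by
  have hn := two_le_matrix_apply hM
  have hmono : ∀ j, Submodule.span ℤ[X] (basisVec M '' {β | β.Starts i ∧ β.Ends j}) ≤
      Submodule.span ℤ[X] (basisVec M '' {β | β.Starts i}) := fun j =>
    Submodule.span_mono (Set.image_mono fun β hβ => hβ.1)
  by_cases h : β.Starts i
  · rw [genX_mul_basisVec_of_starts hM h]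
    exact Submodule.smul_mem _ _ (basisVec_mem_span h)
  · rcases β with _ | _ | ⟨j, k⟩
    · have := hmono i (altProd_genX_mem_span hM i (k := 0) (by omega))
      simpa [basisVec] using this
    · exact (h trivial).elim
    · have hi : i = lead j (k + 1) := fin_two_eq_add_one (Ne.symm h)
      subst hi
      exact hmono j (altProd_genX_mem_span hM j (k := k + 1) (by omega))

include hM in
theorem basisVec_mul_genX_mem (i : Fin 2) (β : BasisIdx M) :
    basisVec M β * genX M i ∈ Submodule.span ℤ[X] (basisVec M '' {β | β.Ends i}) := by
  have hn := two_le_matrix_apply hM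
  have hmono : ∀ j, Submodule.span ℤ[X] (basisVec M '' {β | β.Starts j ∧ β.Ends i}) ≤
      Submodule.span ℤ[X] (basisVec M '' {β | β.Ends i}) := fun j =>
    Submodule.span_mono (Set.image_mono fun β hβ => hβ.2)
  by_cases h : β.Ends i
  · rw [basisVec_mul_genX_of_ends hM h]
    exact Submodule.smul_mem _ _ (basisVec_mem_span h)
  · rcases β with _ | _ | ⟨j, k⟩
    · have := hmono i (altProd_genX_mem_span hM i (k := 0) (by omega))
      simpa [basisVec] using this
    · exact (h trivial).elim
    · obtain rfl : j = i + 1 := fin_two_eq_add_one h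
      have := hmono _ (altProd_genX_mem_span hM i (k := k + 1) (by omega))
      rwa [altProd_succ'] at this

include hM in
theorem span_basisVec : ⊤ ≤ Submodule.span ℤ[X] (Set.range (basisVec M)) := by
  intro h _
  refine hecke_induction (Submodule.subset_span (Set.mem_range_self none)) (fun i x hx => ?_) h
  induction hx using Submodule.span_induction with
  | mem x hx =>
    obtain ⟨β, rfl⟩ := hx
    exact Submodule.span_mono (Set.image_subset_range _ _) (genX_mul_basisVec_mem hM i β)
  | zero => simp
  | add x y _ _ hx hy => rw [mul_add]; exact Submodule.add_mem _ hx hy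
  | smul r x _ hx => rw [mul_smul_comm]; exact Submodule.smul_mem _ _ hx

/-! ### Linear independence from the regular representation -/

/-- The action on the identity element of the group in the regular representation. -/
def regularEval : Hecke M →ₗ[ℤ[X]] (W →₀ ℤ[X]) :=
  LinearMap.applyₗ (Finsupp.single 1 1) ∘ₗ (regularRep cs).toLinearMap

theorem regularEval_apply (h : Hecke M) :
    regularEval cs h = regularRep cs h (Finsupp.single 1 1) := rfl

include hM in
theorem span_regularEval_basisVec :
    ⊤ ≤ Submodule.span ℤ[X] (Set.range (regularEval cs ∘ basisVec M)) := by
  rw [Set.range_comp, ← Submodule.map_span, top_le_iff.1 (span_basisVec hM), Submodule.map_top,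
    top_le_iff, LinearMap.range_eq_top]
  intro v
  induction v using Finsupp.induction_linear with
  | zero => exact ⟨0, map_zero _⟩
  | add v w hv hw =>
    obtain ⟨a, rfl⟩ := hv
    obtain ⟨b, rfl⟩ := hw
    exact ⟨a + b, map_add _ _ _⟩
  | single w r =>
    refine ⟨r • heckeT cs w, ?_⟩
    rw [map_smul, regularEval_apply, regularRep_heckeT, Finsupp.smul_single, smul_eq_mul, mul_one]

include hM in
-- The 2n images span a free module of rank 2n.
theorem linearIndependent_regularEval_basisVec :
    LinearIndependent ℤ[X] (regularEval cs ∘ basisVec M) := by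
  have := finite_of_dihedral cs hM
  have := Fintype.ofFinite W
  refine linearIndependent_of_top_le_span_of_card_le_finrank (span_regularEval_basisVec cs hM) ?_
  have hn := two_le_matrix_apply hM
  have hc := card_dihedral cs hM
  rw [Nat.card_eq_fintype_card] at hc
  rw [Module.finrank_finsupp_self, hc]
  simp
  omega

/-- The basis `1`, `x_{[k]j}` for `1 ≤ k < n`, and `x_S` of the Hecke algebra. -/
def heckeBasis : Module.Basis (BasisIdx M) ℤ[X] (Hecke M) :=
  Module.Basis.mk ((linearIndependent_regularEval_basisVec cs hM).of_comp _) (span_basisVec hM)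

@[simp] theorem heckeBasis_apply (β : BasisIdx M) : heckeBasis cs hM β = basisVec M β := by
  simp [heckeBasis]

-- A basis is sent to a basis. This reduces the computation of the x_I to the free module on W.
include hM in
theorem regularEval_injective : Function.Injective (regularEval cs) := by
  have : regularEval cs = ((heckeBasis cs hM).equiv (Module.Basis.mk
      (linearIndependent_regularEval_basisVec cs hM) (span_regularEval_basisVec cs hM))
      (Equiv.refl _)).toLinearMap := by
    refine (heckeBasis cs hM).ext fun β => ?_
    rw [LinearEquiv.coe_coe, Module.Basis.equiv_apply]
    simp
  rw [this]
  exact LinearEquiv.injective _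

/-! ### Solutions of the eigenvalue equations for x_i -/

theorem one_add_X_ne_zero : (1 + X : ℤ[X]) ≠ 0 := by
  intro h
  simpa using congrArg (Polynomial.eval 0) h

theorem heckeBasis_repr_eq_zero_of_mem {P : BasisIdx M → Prop} {v : Hecke M}
    (hv : v ∈ Submodule.span ℤ[X] (basisVec M '' {β | P β})) {β : BasisIdx M} (hβ : ¬ P β) :
    (heckeBasis cs hM).repr v β = 0 := by
  have : basisVec M = heckeBasis cs hM := funext fun β => (heckeBasis_apply cs hM β).symm
  rw [this, Module.Basis.mem_span_image] at hv
  by_contra h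
  exact hβ (hv (Finsupp.mem_support_iff.2 h))

/-- The product x_i v always lies in the span of the vectors with `Starts i`. Here it equals (1 + q)
v, and 1 + q can be cancelled from each coordinate. -/
theorem heckeBasis_repr_eq_zero_of_left {v : Hecke M} {i : Fin 2}
    (hv : genX M i * v = (1 + X : ℤ[X]) • v) {β : BasisIdx M} (hβ : ¬ β.Starts i) :
    (heckeBasis cs hM).repr v β = 0 := by
  have h : genX M i * v ∈ Submodule.span ℤ[X] (basisVec M '' {β | β.Starts i}) := by
    have hle : Submodule.span ℤ[X] (Set.range (basisVec M)) ≤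
        (Submodule.span ℤ[X] (basisVec M '' {β | β.Starts i})).comap
          (LinearMap.mulLeft ℤ[X] (genX M i)) := by
      rw [Submodule.span_le]
      rintro _ ⟨γ, rfl⟩
      exact genX_mul_basisVec_mem hM i γ
    exact hle (span_basisVec hM trivial)
  rw [hv] at h
  have := heckeBasis_repr_eq_zero_of_mem cs hM h hβ
  rw [map_smul, Finsupp.smul_apply, smul_eq_mul] at this
  exact (mul_eq_zero.1 this).resolve_left one_add_X_ne_zero

theorem heckeBasis_repr_eq_zero_of_right {v : Hecke M} {i : Fin 2}
    (hv : v * genX M i = (1 + X : ℤ[X]) • v) {β : BasisIdx M} (hβ : ¬ β.Ends i) :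
    (heckeBasis cs hM).repr v β = 0 := by
  have h : v * genX M i ∈ Submodule.span ℤ[X] (basisVec M '' {β | β.Ends i}) := by
    have hle : Submodule.span ℤ[X] (Set.range (basisVec M)) ≤
        (Submodule.span ℤ[X] (basisVec M '' {β | β.Ends i})).comap
          (LinearMap.mulRight ℤ[X] (genX M i)) := by
      rw [Submodule.span_le]
      rintro _ ⟨γ, rfl⟩
      exact basisVec_mul_genX_mem hM i γ
    exact hle (span_basisVec hM trivial)
  rw [hv] at h
  have := heckeBasis_repr_eq_zero_of_mem cs hM h hβ
  rw [map_smul, Finsupp.smul_apply, smul_eq_mul] at this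
  exact (mul_eq_zero.1 this).resolve_left one_add_X_ne_zero

/-! ### The elements `x_I` -/

theorem regularEval_heckeX (I : Finitary cs) :
    regularEval cs (heckeX cs I) = ∑ w ∈ I.2.toFinset, Finsupp.single w 1 := by
  rw [heckeX, map_sum]
  exact Finset.sum_congr rfl fun w _ => regularRep_heckeT cs w

theorem heckeX_vBot : heckeX cs (vBot cs hM) = 1 := by
  refine regularEval_injective cs hM ?_
  have : (vBot cs hM).2.toFinset = {1} := by
    ext w
    simp [vBot, parabolic]
  rw [regularEval_heckeX, this, regularEval_apply]
  simp

theorem heckeX_vMid (i : Fin 2) : heckeX cs (vMid cs hM i) = genX M i := by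
  classical
  refine regularEval_injective cs hM ?_
  have h1 : (1 : W) ≠ cs.simple i := by
    intro h
    have := cs.length_simple i
    simp [← h] at this
  have : (vMid cs hM i).2.toFinset = {1, cs.simple i} := by
    ext w
    rw [Set.Finite.mem_toFinset, SetLike.mem_coe]
    simp only [vMid, parabolic, Finset.coe_singleton, Set.image_singleton,
      Subgroup.mem_closure_singleton, Finset.mem_insert, Finset.mem_singleton]
    constructor
    · rintro ⟨k, rfl⟩
      rcases Int.even_or_odd' k with ⟨r, rfl | rfl⟩
      · left
        rw [zpow_mul, zpow_ofNat, cs.simple_sq, one_zpow]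
      · right
        rw [zpow_add, zpow_mul, zpow_ofNat, cs.simple_sq, one_zpow, one_mul, zpow_one]
    · rintro (rfl | rfl)
      · exact ⟨0, zpow_zero _⟩
      · exact ⟨1, zpow_one _⟩
  have h2 := regularRep_altProd cs i (k := 1) (by omega)
  rw [altProd_one, altProd_one] at h2
  rw [regularEval_heckeX, this, Finset.sum_pair h1, map_add, regularEval_apply, regularEval_apply,
    h2, map_one, Module.End.one_apply]

theorem heckeX_vTop : heckeX cs (vTop cs hM) = heckeSum M := by
  refine regularEval_injective cs hM ?_
  have := finite_of_dihedral cs hM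
  have := Fintype.ofFinite W
  have h : (vTop cs hM).2.toFinset = Finset.univ := by
    ext w
    rw [Set.Finite.mem_toFinset, SetLike.mem_coe]
    simp [vTop, parabolic, cs.subgroup_closure_range_simple]
  rw [regularEval_heckeX, h, heckeSum, sum_altProd_add, map_sum,
    ← (Equiv.ofBijective _ (dihedralElt_bijective cs hM 0)).sum_comp, Fintype.sum_sum_type,
    ← Fin.sum_univ_eq_sum_range
      (fun k => regularEval cs (altProd (Hecke.gen M) (0 + 1) k + altProd (Hecke.gen M) 0 (k + 1))),
    ← Finset.sum_add_distrib]
  refine Finset.sum_congr rfl fun k _ => ?_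
  rw [map_add, regularEval_apply, regularEval_apply, regularRep_altProd cs _ k.2.le,
    regularRep_altProd cs _ (k := k + 1) k.2]
  rfl

theorem mul_eq_smul_of_one_add_mul {R : Type*} [Ring R] [Algebra ℤ[X] R] {t v : R}
    (h : (1 + t) * v = (1 + X : ℤ[X]) • v) : t * v = (X : ℤ[X]) • v := by
  rwa [add_mul, one_mul, add_smul, one_smul, add_right_inj] at h

theorem mul_heckeSum_pow (hM : M 0 1 ≠ 0) (i : Fin 2) (k : ℕ) :
    altProd (Hecke.gen M) i k * heckeSum M = (X ^ k : ℤ[X]) • heckeSum M := by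
  induction k with
  | zero => simp
  | succ k ih =>
    have h := genX_mul_heckeSum hM (lead i k)
    replace h := mul_eq_smul_of_one_add_mul (R := Hecke M) h
    rw [altProd_succ, mul_assoc, ih, mul_smul_comm, h, smul_smul, pow_succ]

end HeckeBasis

/-! ### The universal property of path algebras -/

namespace PathAlgebra

section Lift

variable {R V A : Type*} [CommRing R] [Quiver V] [Semiring A] [Algebra R A]

/-- The value of a path, given the values of the vertices and of the arrows. -/
def pathVal (ε : V → A) (α : ∀ {a b : V}, (a ⟶ b) → A) {a : V} : ∀ {b : V}, Quiver.Path a b → A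
  | _, .nil => ε a
  | _, .cons p f => α f * pathVal ε α p

variable {ε : V → A} {α : ∀ {a b : V}, (a ⟶ b) → A}

theorem pathVal_mul (idem : ∀ a, ε a * ε a = ε a) {a b : V} (p : Quiver.Path a b) :
    pathVal ε α p * ε a = pathVal ε α p := by
  induction p with
  | nil => exact idem a
  | cons p f ih => rw [pathVal, mul_assoc, ih]

theorem mul_pathVal (idem : ∀ a, ε a * ε a = ε a)
    (target_mul : ∀ {a b : V} (f : a ⟶ b), ε b * α f = α f) {a b : V} (p : Quiver.Path a b) :
    ε b * pathVal ε α p = pathVal ε α p := by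
  cases p with
  | nil => exact idem a
  | cons p f => rw [pathVal, ← mul_assoc, target_mul]

theorem pathVal_comp (idem : ∀ a, ε a * ε a = ε a)
    (target_mul : ∀ {a b : V} (f : a ⟶ b), ε b * α f = α f)
    {a b c : V} (p : Quiver.Path a b) (q : Quiver.Path b c) :
    pathVal ε α (p.comp q) = pathVal ε α q * pathVal ε α p := by
  induction q with
  | nil => exact (mul_pathVal idem target_mul p).symm
  | cons q f ih => rw [Quiver.Path.comp_cons, pathVal, ih, pathVal, mul_assoc]

theorem e_mul_e (a : V) : (e a * e a : PathAlgebra R V) = e a := by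
  rw [e, ofPath_mul_ofPath, mulPath_comp, Quiver.Path.comp_nil]

theorem e_mul_arrow {a b : V} (f : a ⟶ b) : (e b * arrow f : PathAlgebra R V) = arrow f := by
  rw [e, arrow, ofPath_mul_ofPath, mulPath_comp, Quiver.Path.comp_nil]

theorem arrow_mul_e {a b : V} (f : a ⟶ b) : (arrow f * e a : PathAlgebra R V) = arrow f := by
  rw [e, arrow, ofPath_mul_ofPath, mulPath_comp, Quiver.Path.nil_comp]

theorem arrow_mul_ofPath {a b c : V} (f : b ⟶ c) (p : Quiver.Path a b) :
    (arrow f * ofPath ⟨a, b, p⟩ : PathAlgebra R V) = ofPath ⟨a, c, p.cons f⟩ := by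
  rw [arrow, ofPath_mul_ofPath, mulPath_comp]
  rfl

variable [Fintype V]

/-- The algebra homomorphism from a path algebra given by a complete family of orthogonal
idempotents and by the images of the arrows. -/
def lift (ε : V → A) (α : ∀ {a b : V}, (a ⟶ b) → A) (idem : ∀ a, ε a * ε a = ε a)
    (ortho : ∀ a b, a ≠ b → ε a * ε b = 0) (complete : ∑ a, ε a = 1)
    (target_mul : ∀ {a b : V} (f : a ⟶ b), ε b * α f = α f) : PathAlgebra R V →ₐ[R] A :=
  AlgHom.ofLinearMap (pathBasis.constr R fun p => pathVal ε α p.2.2)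
    (by
      rw [one_def, map_sum, ← complete]
      exact Finset.sum_congr rfl fun a _ => pathBasis.constr_basis R _ _)
    (by
      intro x y
      induction x using induction_on with
      | zero => simp
      | add _ _ h h' => rw [add_mul, map_add, map_add, h, h', add_mul]
      | smul r _ h => rw [smul_mul_assoc, map_smul, map_smul, h, smul_mul_assoc]
      | path p
      induction y using induction_on with
      | zero => simp
      | add _ _ h h' => rw [mul_add, map_add, map_add, h, h', mul_add]
      | smul r _ h => rw [mul_smul_comm, map_smul, map_smul, h, mul_smul_comm]
      | path q
      obtain ⟨b, c, p⟩ := p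
      obtain ⟨a, b', q⟩ := q
      rw [ofPath_mul_ofPath]
      by_cases h : b' = b
      · subst h
        rw [mulPath_comp, ofPath, ofPath, ofPath, Module.Basis.constr_basis,
          Module.Basis.constr_basis, Module.Basis.constr_basis, pathVal_comp idem target_mul]
      · rw [mulPath_of_ne _ _ h, ofPath, ofPath, Module.Basis.constr_basis,
          Module.Basis.constr_basis, map_zero]
        dsimp only
        -- For paths that do not compose, the idempotents at the mismatched ends are inserted and
        -- annihilate each other.
        rw [← pathVal_mul idem p, ← mul_pathVal idem target_mul q, mul_assoc,
          ← mul_assoc (ε b), ortho _ _ (Ne.symm h), zero_mul, mul_zero])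

variable (idem : ∀ a, ε a * ε a = ε a) (ortho : ∀ a b, a ≠ b → ε a * ε b = 0)
  (complete : ∑ a, ε a = 1) (target_mul : ∀ {a b : V} (f : a ⟶ b), ε b * α f = α f)

theorem lift_e (a : V) :
    lift (R := R) ε α idem ortho complete target_mul (e a) = ε a :=
  pathBasis.constr_basis R _ _

/-- The value of a one-arrow path carries the idempotent of its source, which `mul_source` absorbs.
-/
theorem lift_arrow {a b : V} (f : a ⟶ b) (mul_source : α f * ε a = α f) :
    lift (R := R) ε α idem ortho complete target_mul (arrow f) = α f := by
  refine (pathBasis.constr_basis R _ _).trans ?_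
  change α f * ε a = α f
  exact mul_source

end Lift

end PathAlgebra

/-! ### Matrix units in the Hecke endomorphism algebra -/

section Block

variable {B W : Type*} [Group W] {M : CoxeterMatrix B} {cs : CoxeterSystem M W}

theorem heckeX_mem (I : Finitary cs) : heckeX cs I ∈ heckeIdeal cs I :=
  Submodule.mem_span_singleton_self _

/-- The generator `x_I` of the `I`-th summand. -/
def heckeGen (I : Finitary cs) : heckeIdeal cs I := ⟨heckeX cs I, heckeX_mem I⟩

theorem exists_eq_heckeX_mul {I : Finitary cs} {h : Hecke M} (hh : h ∈ heckeIdeal cs I) :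
    ∃ a, h = heckeX cs I * a := by
  obtain ⟨a, rfl⟩ := Submodule.mem_span_singleton.1 hh
  exact ⟨a.unop, rfl⟩

theorem heckeX_mul_mem (I : Finitary cs) (a : Hecke M) : heckeX cs I * a ∈ heckeIdeal cs I :=
  Submodule.smul_mem _ (MulOpposite.op a) (heckeX_mem I)

/-- The endomorphism `φ` maps the `I`-th summand to the `J`-th summand by left multiplication
with `y`, and the other summands to zero. -/
def IsBlock (φ : HeckeEnd cs) (J I : Finitary cs) (y : Hecke M) : Prop :=
  ∀ n K, ((φ n K : heckeIdeal cs K) : Hecke M) =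
    open Classical in if K = J then y * (n I : Hecke M) else 0

theorem heckeEnd_ext {φ ψ : HeckeEnd cs}
    (h : ∀ n K, ((φ n K : heckeIdeal cs K) : Hecke M) = ψ n K) :
    φ = ψ :=
  LinearMap.ext fun n => DFinsupp.ext fun K => Subtype.ext (h n K)

variable {φ ψ : HeckeEnd cs} {I J K L : Finitary cs} {y z : Hecke M}

theorem IsBlock.mul (hφ : IsBlock φ K J y) (hψ : IsBlock ψ J I z) :
    IsBlock (φ * ψ) K I (y * z) := by
  intro n L
  rw [Module.End.mul_apply, hφ, hψ, if_pos rfl, mul_assoc]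

theorem IsBlock.mul_eq_zero (hφ : IsBlock φ K J y) (hψ : IsBlock ψ L I z) (h : J ≠ L) :
    φ * ψ = 0 := by
  refine heckeEnd_ext fun n N => ?_
  rw [Module.End.mul_apply, hφ, hψ, if_neg h, mul_zero, ite_self]
  rfl

theorem mul_eq_mul_of_mem (h : y * heckeX cs I = z * heckeX cs I) {a : Hecke M}
    (ha : a ∈ heckeIdeal cs I) : y * a = z * a := by
  obtain ⟨a, rfl⟩ := exists_eq_heckeX_mul ha
  rw [← mul_assoc, h, mul_assoc]

/-- The multiplier is not unique: only its product with the generator x_I matters. Every identity of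
blocks is thereby checked on x_I. -/
theorem IsBlock.congr (hφ : IsBlock φ J I y) (h : y * heckeX cs I = z * heckeX cs I) :
    IsBlock φ J I z := by
  intro n K
  rw [hφ, mul_eq_mul_of_mem h (n I).2]

theorem IsBlock.ext (hφ : IsBlock φ J I y) (hψ : IsBlock ψ J I z)
    (h : y * heckeX cs I = z * heckeX cs I) : φ = ψ :=
  heckeEnd_ext fun n K => by rw [hφ.congr h, hψ]

theorem IsBlock.add (hφ : IsBlock φ J I y) (hψ : IsBlock ψ J I z) :
    IsBlock (φ + ψ) J I (y + z) := by
  classical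
  intro n K
  have : ((φ + ψ) n K : heckeIdeal cs K) = φ n K + ψ n K := rfl
  rw [this, Submodule.coe_add, hφ, hψ]
  split_ifs
  · rw [add_mul]
  · rw [add_zero]

theorem IsBlock.smul (r : ℤ[X]) (hφ : IsBlock φ J I y) : IsBlock (r • φ) J I (r • y) := by
  classical
  intro n K
  have : (((r • φ) n K : heckeIdeal cs K) : Hecke M) = r • (φ n K : Hecke M) := rfl
  rw [this, hφ]
  split_ifs
  · rw [smul_mul_assoc]
  · rw [smul_zero]

theorem isBlock_zero : IsBlock (0 : HeckeEnd cs) J I 0 := by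
  classical
  intro n K
  rw [zero_mul, ite_self]
  rfl

theorem IsBlock.sum {ι : Type*} (s : Finset ι) {f : ι → HeckeEnd cs} {g : ι → Hecke M}
    (h : ∀ i ∈ s, IsBlock (f i) J I (g i)) : IsBlock (∑ i ∈ s, f i) J I (∑ i ∈ s, g i) := by
  classical
  induction s using Finset.induction_on with
  | empty => exact isBlock_zero
  | insert i s hi ih =>
    rw [Finset.sum_insert hi, Finset.sum_insert hi]
    exact (h i (Finset.mem_insert_self i s)).add
      (ih fun j hj => h j (Finset.mem_insert_of_mem hj))

open Classical in
/-- The endomorphism that maps the `I`-th summand to the `J`-th summand by left multiplication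
with `y`, and the other summands to zero. -/
def block (J I : Finitary cs) (y : Hecke M) (hy : y * heckeX cs I ∈ heckeIdeal cs J) :
    HeckeEnd cs :=
  DirectSum.lof (Hecke M)ᵐᵒᵖ (Finitary cs) (fun I => heckeIdeal cs I) J ∘ₗ
    LinearMap.restrict (p := heckeIdeal cs I) (q := heckeIdeal cs J)
      ({ toFun := fun a => y * a
         map_add' := mul_add y
         map_smul' := fun r a => (mul_assoc y a r.unop).symm } :
          Hecke M →ₗ[(Hecke M)ᵐᵒᵖ] Hecke M)
      (by
        intro a ha
        obtain ⟨a, rfl⟩ := exists_eq_heckeX_mul ha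
        change y * (heckeX cs I * a) ∈ _
        rw [← mul_assoc]
        exact Submodule.smul_mem _ (MulOpposite.op a) hy) ∘ₗ
    DirectSum.component (Hecke M)ᵐᵒᵖ (Finitary cs) (fun I => heckeIdeal cs I) I

theorem isBlock_block (hy : y * heckeX cs I ∈ heckeIdeal cs J) :
    IsBlock (block J I y hy) J I y := by
  classical
  intro n K
  by_cases h : K = J
  · subst h
    rw [if_pos rfl]
    change ((DirectSum.lof (Hecke M)ᵐᵒᵖ (Finitary cs) (fun I => heckeIdeal cs I) K _ :
      DirectSum _ _) K : Hecke M) = _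
    rw [DirectSum.lof_apply]
    rfl
  · rw [if_neg h]
    change ((DirectSum.lof (Hecke M)ᵐᵒᵖ (Finitary cs) (fun I => heckeIdeal cs I) J _ :
      DirectSum _ _) K : Hecke M) = _
    rw [DirectSum.lof_eq_of, DirectSum.of_eq_of_ne _ _ _ h]
    rfl

/-- The projection onto the `I`-th summand. -/
def blockOne (I : Finitary cs) : HeckeEnd cs :=
  block I I 1 (by rw [one_mul]; exact heckeX_mem I)

theorem isBlock_blockOne (I : Finitary cs) : IsBlock (blockOne I) I I 1 := isBlock_block _

theorem sum_blockOne [Finite B] : ∑ I, blockOne I = (1 : HeckeEnd cs) := by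
  classical
  refine heckeEnd_ext fun n K => ?_
  rw [LinearMap.sum_apply, DFinsupp.finsetSum_apply, Submodule.coe_sum]
  simp only [isBlock_blockOne _ n K, one_mul]
  simp

open Classical in
/-- The `(J, I)`-entry of an endomorphism: its `J`-th component at `x_I`. -/
def entry (J I : Finitary cs) : HeckeEnd cs →ₗ[ℤ[X]] Hecke M where
  toFun φ := (φ (DirectSum.lof (Hecke M)ᵐᵒᵖ (Finitary cs) (fun I => heckeIdeal cs I) I
    (heckeGen I)) J : heckeIdeal cs J)
  map_add' _ _ := rfl
  map_smul' _ _ := rfl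

theorem IsBlock.entry_self (h : IsBlock φ J I y) : entry J I φ = y * heckeX cs I := by
  classical
  refine (h _ _).trans ?_
  rw [if_pos rfl, DirectSum.lof_apply]
  rfl

theorem IsBlock.entry_of_ne (h : IsBlock φ J I y) (hne : ¬ (K = J ∧ L = I)) :
    entry K L φ = 0 := by
  classical
  refine (h _ _).trans ?_
  split_ifs with hK
  · rw [DirectSum.lof_eq_of, DirectSum.of_eq_of_ne _ _ _ fun h => hne ⟨hK, h.symm⟩]
    exact mul_zero _
  · rfl

/-- Each summand is cyclic, generated by x_I. -/
theorem entry_ext (h : ∀ J I, entry J I φ = entry J I ψ) : φ = ψ := by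
  classical
  refine DirectSum.linearMap_ext _ fun I => LinearMap.ext fun a => ?_
  obtain ⟨a, ha⟩ := a
  obtain ⟨a, rfl⟩ := exists_eq_heckeX_mul ha
  have e : (⟨heckeX cs I * a, ha⟩ : heckeIdeal cs I) = MulOpposite.op a • heckeGen I := rfl
  rw [e, map_smul, map_smul]
  congr 1
  exact DFinsupp.ext fun J => Subtype.ext (h J I)

theorem entry_mem (J I : Finitary cs) (φ : HeckeEnd cs) : entry J I φ ∈ heckeIdeal cs J :=
  Subtype.prop _

/-- By right linearity, an equation satisfied by x_I passes to its image; this gives the right-hand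
eigenvalue equations of an entry. -/
theorem entry_mul_eq_smul {r : ℤ[X]} {a : Hecke M} (h : heckeX cs I * a = r • heckeX cs I)
    (J : Finitary cs) (φ : HeckeEnd cs) : entry J I φ * a = r • entry J I φ := by
  classical
  have e : MulOpposite.op a • heckeGen I =
      MulOpposite.op (algebraMap ℤ[X] (Hecke M) r) • heckeGen I := by
    refine Subtype.ext ?_
    change heckeX cs I * a = heckeX cs I * algebraMap ℤ[X] (Hecke M) r
    rw [h, ← Algebra.commutes, ← Algebra.smul_def]
  have e1 : ∀ b, entry J I φ * b = ((φ (DirectSum.lof (Hecke M)ᵐᵒᵖ (Finitary cs)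
      (fun I => heckeIdeal cs I) I (MulOpposite.op b • heckeGen I)) J : heckeIdeal cs J) :
        Hecke M) := by
    intro b
    rw [map_smul, map_smul]
    rfl
  rw [e1, e, ← e1, ← Algebra.commutes, ← Algebra.smul_def]

end Block

/-! ### The sums in the refined braid relations -/

theorem bCoeff_one_of_even {n : ℕ} (hn : Even n) : bCoeff n 1 = 0 := by
  rcases n with _ | n
  · exact bCoeff_eq_zero_of_lt one_pos
  · refine bCoeff_eq_zero_of_not_even fun h => ?_
    rw [Nat.even_add_one] at hn
    exact hn h

theorem bCoeff_one_of_odd {n : ℕ} (hn : Odd n) : bCoeff n 1 = (-X) ^ ((n - 1) / 2) := by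
  obtain ⟨r, rfl⟩ := hn
  have h1 : 2 * r + 1 - 1 = 2 * r := by omega
  have h2 : 2 * r / 2 = r := by omega
  have h3 : 2 * r + 1 - r - 1 = r := by omega
  rw [bCoeff, if_pos ⟨by omega, by rw [h1]; simp⟩, h1, h2, h3, Nat.choose_self, Nat.cast_one,
    one_mul]

section

variable {N : Type*} [AddCommMonoid N] [Module ℤ[X] N]

theorem sum_Icc_two_bCoeff (n : ℕ) (f : ℕ → N) : ∑ j ∈ Finset.Icc 2 n, bCoeff n j • f (j - 2) =
    ∑ k ∈ Finset.range (n - 1), bCoeff n (k + 2) • f k := by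
  have h : Finset.Icc 2 n = Finset.Ico 2 (n + 1) := by
    ext
    simp
  rw [h, Finset.sum_Ico_eq_sum_range, show n + 1 - 2 = n - 1 by omega]
  refine Finset.sum_congr rfl fun k _ => ?_
  rw [add_comm 2 k, Nat.add_sub_cancel]

theorem sum_Icc_three_bCoeff {n : ℕ} (hn : Odd n) (f : ℕ → N) :
    ∑ j ∈ Finset.Icc 3 n, bCoeff n j • f (j - 2) =
      ∑ k ∈ Finset.range (n - 1), bCoeff n (k + 2) • f k := by
  rw [← sum_Icc_two_bCoeff]
  refine Finset.sum_subset (Finset.Icc_subset_Icc_left (by omega)) fun j hj hj' => ?_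
  obtain rfl : j = 2 := by
    rw [Finset.mem_Icc] at hj hj'
    omega
  -- For odd n the term j = 2 has the wrong parity, so the sum may start at 2 or at 3.
  rw [bCoeff_eq_zero_of_not_even, zero_smul]
  rw [Nat.even_sub (Finset.mem_Icc.1 hj).2]
  simpa using hn

end

theorem lead_sub_one_of_even (s : Fin 2) {n : ℕ} (h0 : n ≠ 0) (hn : Even n) :
    lead s (n - 1) = s + 1 := by
  obtain ⟨r, rfl⟩ := hn
  rw [show r + r - 1 = 1 + 2 * (r - 1) by omega, lead_add_two_mul]
  rfl

theorem lead_sub_one_of_odd (s : Fin 2) {n : ℕ} (hn : Odd n) : lead s (n - 1) = s := by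
  obtain ⟨r, rfl⟩ := hn
  rw [show 2 * r + 1 - 1 = 0 + 2 * r by omega, lead_add_two_mul]
  rfl

/-! ### The action of the path algebra -/

section Action

variable {W : Type*} [Group W] {M : CoxeterMatrix (Fin 2)} (cs : CoxeterSystem M W)
  (hM : M 0 1 ≠ 0)

theorem vertex_cases (I : Finitary cs) :
    I = vBot cs hM ∨ (∃ i, I = vMid cs hM i) ∨ I = vTop cs hM := by
  have h : ∀ s : Finset (Fin 2), s = ∅ ∨ (∃ i, s = {i}) ∨ s = Finset.univ := by decide
  rcases h I.1 with h | ⟨i, h⟩ | h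
  · exact .inl (Subtype.ext h)
  · exact .inr (.inl ⟨i, Subtype.ext h⟩)
  · exact .inr (.inr (Subtype.ext h))

theorem vMid_injective : Function.Injective (vMid cs hM) := fun _ _ h =>
  Finset.singleton_injective (congrArg Subtype.val h)

@[simp] theorem vMid_inj {i j : Fin 2} : vMid cs hM i = vMid cs hM j ↔ i = j :=
  (vMid_injective cs hM).eq_iff

@[simp] theorem vMid_ne_vBot (i : Fin 2) : vMid cs hM i ≠ vBot cs hM := fun h => by
  simpa [vMid, vBot] using congrArg Subtype.val h

@[simp] theorem vTop_ne_vBot : vTop cs hM ≠ vBot cs hM := fun h => by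
  have h' : (Finset.univ : Finset (Fin 2)) = ∅ := congrArg Subtype.val h
  revert h'
  decide

@[simp] theorem vMid_ne_vTop (i : Fin 2) : vMid cs hM i ≠ vTop cs hM := fun h => by
  have h' : ({i} : Finset (Fin 2)) = Finset.univ := congrArg Subtype.val h
  clear h
  revert i
  decide

theorem covers_cases {I J : Finitary cs} (h : Covers I J) :
    (∃ i, I = vBot cs hM ∧ J = vMid cs hM i) ∨ (∃ i, I = vMid cs hM i ∧ J = vTop cs hM) := by
  have key : ∀ s t : Finset (Fin 2), s ⊆ t ∧ s.card + 1 = t.card →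
      (∃ i, s = ∅ ∧ t = {i}) ∨ (∃ i, s = {i} ∧ t = Finset.univ) := by decide
  rcases key _ _ h with ⟨i, h1, h2⟩ | ⟨i, h1, h2⟩
  · exact .inl ⟨i, Subtype.ext h1, Subtype.ext h2⟩
  · exact .inr ⟨i, Subtype.ext h1, Subtype.ext h2⟩

/-- The sum of the `T_w` over the minimal representatives of the left cosets of the `i`-th simple
reflection. -/
def cosetWeight (M : CoxeterMatrix (Fin 2)) (i : Fin 2) : Hecke M :=
  ∑ k ∈ Finset.range (M 0 1), altProd (Hecke.gen M) (i + 1) k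

include hM in
theorem cosetWeight_mul_genX (i : Fin 2) : cosetWeight M i * genX M i = heckeSum M :=
  cosetSum_eq_heckeSum hM i

include hM in
theorem exists_heckeSum_eq_genX_mul (i : Fin 2) : ∃ a, heckeSum M = genX M i * a := by
  obtain ⟨m, hm⟩ : ∃ m, M 0 1 = m + 1 := ⟨M 0 1 - 1, by omega⟩
  -- The last letter j is chosen so that the products of length n begin with x_i; by parity so do
  -- all products with nonzero coefficient.
  obtain ⟨j, rfl⟩ := exists_lead_eq i m
  refine ⟨∑ k ∈ Finset.range (M 0 1), bCoeff (M 0 1) (k + 1) • altProd (genX M) j k, ?_⟩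
  rw [heckeSum_eq_sum_bCoeff hM j, Finset.mul_sum]
  refine Finset.sum_congr rfl fun k hk => ?_
  rw [mul_smul_comm]
  by_cases h : Even (m + 1 - (k + 1))
  · have hk' : k ≤ m := by have := Finset.mem_range.1 hk; omega
    rw [lead_eq_of_even_sub j hk' h, altProd_succ]
  · rw [hm, bCoeff_eq_zero_of_not_even h, zero_smul, zero_smul]

include hM in
theorem cosetWeight_mul_heckeSum (i : Fin 2) : cosetWeight M i * heckeSum M =
    (∑ k ∈ Finset.range (M 0 1), X ^ k : ℤ[X]) • heckeSum M := by
  rw [cosetWeight, Finset.sum_mul, Finset.sum_smul]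
  exact Finset.sum_congr rfl fun k _ => mul_heckeSum_pow hM _ _

include hM in
theorem exists_mul_heckeX {I J : Finitary cs} (h : Covers I J) :
    ∃ y, y * heckeX cs I = heckeX cs J := by
  rcases covers_cases cs hM h with ⟨i, rfl, rfl⟩ | ⟨i, rfl, rfl⟩
  · exact ⟨heckeX cs (vMid cs hM i), by rw [heckeX_vBot, mul_one]⟩
  · exact ⟨cosetWeight M i, by rw [heckeX_vMid, heckeX_vTop, cosetWeight_mul_genX hM]⟩

include hM in
theorem heckeX_mem_of_covers {I J : Finitary cs} (h : Covers I J) :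
    heckeX cs J ∈ heckeIdeal cs I := by
  rcases covers_cases cs hM h with ⟨i, rfl, rfl⟩ | ⟨i, rfl, rfl⟩
  · have := heckeX_mul_mem (vBot cs hM) (heckeX cs (vMid cs hM i))
    rwa [heckeX_vBot, one_mul] at this
  · obtain ⟨a, ha⟩ := exists_heckeSum_eq_genX_mul hM i
    rw [heckeX_vTop, ha, ← heckeX_vMid cs hM]
    exact heckeX_mul_mem _ a

include hM in
theorem choose_mul_heckeX_mem {I J : Finitary cs} (h : Covers I J) :
    (exists_mul_heckeX cs hM h).choose * heckeX cs I ∈ heckeIdeal cs J := by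
  rw [(exists_mul_heckeX cs hM h).choose_spec]
  exact heckeX_mem J

include hM in
theorem one_mul_heckeX_mem {I J : Finitary cs} (h : Covers I J) :
    1 * heckeX cs J ∈ heckeIdeal cs I := by
  rw [one_mul]
  exact heckeX_mem_of_covers cs hM h

/-- The image of an arrow of the Hasse quiver in the Hecke endomorphism algebra. -/
def arrowBlock {I J : Finitary cs} : (I ⟶ J) → HeckeEnd cs
  | .inl h => block J I _ (choose_mul_heckeX_mem cs hM h.down)
  | .inr h => block J I _ (one_mul_heckeX_mem cs hM h.down)

/-- Frees the image of δ from the chosen multiplier: any y with y x_I = x_J describes it. -/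
theorem isBlock_arrowBlock_inl {I J : Finitary cs} (h : Covers I J) {y : Hecke M}
    (hy : y * heckeX cs I = heckeX cs J) :
    IsBlock (arrowBlock cs hM (I := I) (J := J) (.inl ⟨h⟩)) J I y :=
  (isBlock_block (choose_mul_heckeX_mem cs hM h)).congr
    ((exists_mul_heckeX cs hM h).choose_spec.trans hy.symm)

theorem isBlock_arrowBlock_inr {I J : Finitary cs} (h : Covers J I) :
    IsBlock (arrowBlock cs hM (I := I) (J := J) (.inr ⟨h⟩)) J I 1 :=
  isBlock_block (one_mul_heckeX_mem cs hM h)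

theorem exists_isBlock_arrowBlock {I J : Finitary cs} (f : I ⟶ J) :
    ∃ y, IsBlock (arrowBlock cs hM f) J I y := by
  rcases f with h | h
  · exact ⟨_, isBlock_block (choose_mul_heckeX_mem cs hM h.down)⟩
  · exact ⟨_, isBlock_block (one_mul_heckeX_mem cs hM h.down)⟩

theorem blockOne_mul_arrowBlock {I J : Finitary cs} (f : I ⟶ J) :
    blockOne J * arrowBlock cs hM f = arrowBlock cs hM f := by
  obtain ⟨y, hy⟩ := exists_isBlock_arrowBlock cs hM f
  exact ((isBlock_blockOne J).mul hy).ext hy (by rw [one_mul])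

theorem arrowBlock_mul_blockOne {I J : Finitary cs} (f : I ⟶ J) :
    arrowBlock cs hM f * blockOne I = arrowBlock cs hM f := by
  obtain ⟨y, hy⟩ := exists_isBlock_arrowBlock cs hM f
  exact (hy.mul (isBlock_blockOne I)).ext hy (by rw [mul_one])

/-- The homomorphism from the path algebra to the Hecke endomorphism algebra. -/
def pathHom : HassePath cs →ₐ[ℤ[X]] HeckeEnd cs :=
  PathAlgebra.lift blockOne (arrowBlock cs hM)
    (fun a => ((isBlock_blockOne a).mul (isBlock_blockOne a)).ext (isBlock_blockOne a)
      (by rw [one_mul]))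
    (fun a b h => (isBlock_blockOne a).mul_eq_zero (isBlock_blockOne b) h) sum_blockOne
    (blockOne_mul_arrowBlock cs hM)

theorem isBlock_pathHom_e (I : Finitary cs) : IsBlock (pathHom cs hM (PathAlgebra.e I)) I I 1 := by
  rw [pathHom, PathAlgebra.lift_e]
  exact isBlock_blockOne I

theorem pathHom_arrow {I J : Finitary cs} (f : I ⟶ J) :
    pathHom cs hM (PathAlgebra.arrow f) = arrowBlock cs hM f := by
  rw [pathHom, PathAlgebra.lift_arrow]
  exact arrowBlock_mul_blockOne cs hM f

theorem isBlock_dBot (i : Fin 2) :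
    IsBlock (pathHom cs hM (dBot cs hM i)) (vMid cs hM i) (vBot cs hM) (genX M i) := by
  rw [dBot, delta, pathHom_arrow]
  exact isBlock_arrowBlock_inl cs hM _ (by rw [heckeX_vBot, heckeX_vMid, mul_one])

theorem isBlock_dTop (i : Fin 2) :
    IsBlock (pathHom cs hM (dTop cs hM i)) (vTop cs hM) (vMid cs hM i) (cosetWeight M i) := by
  rw [dTop, delta, pathHom_arrow]
  exact isBlock_arrowBlock_inl cs hM _
    (by rw [heckeX_vTop, heckeX_vMid, cosetWeight_mul_genX hM])

theorem isBlock_uBot (i : Fin 2) :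
    IsBlock (pathHom cs hM (uBot cs hM i)) (vBot cs hM) (vMid cs hM i) 1 := by
  rw [uBot, upsilon, pathHom_arrow]
  exact isBlock_arrowBlock_inr cs hM _

theorem isBlock_uTop (i : Fin 2) :
    IsBlock (pathHom cs hM (uTop cs hM i)) (vMid cs hM i) (vTop cs hM) 1 := by
  rw [uTop, upsilon, pathHom_arrow]
  exact isBlock_arrowBlock_inr cs hM _

/-! ### Products of the arrows -/

theorem e_mul_uBot (i : Fin 2) : PathAlgebra.e (vBot cs hM) * uBot cs hM i = uBot cs hM i :=
  PathAlgebra.e_mul_arrow _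

theorem e_mul_chi (i : Fin 2) : PathAlgebra.e (vBot cs hM) * chi cs hM i = chi cs hM i := by
  rw [chi, ← mul_assoc, e_mul_uBot]

theorem chi_mul_e (i : Fin 2) : chi cs hM i * PathAlgebra.e (vBot cs hM) = chi cs hM i := by
  rw [chi, mul_assoc, dBot, delta, PathAlgebra.arrow_mul_e]

theorem chiAlt_zero (t : Fin 2) : chiAlt cs hM (t + 1) t 0 = PathAlgebra.e (vBot cs hM) := by
  rw [chiAlt, prod_map_alternatingWord, altProd_zero, mul_one]

theorem chiAlt_succ (t : Fin 2) (k : ℕ) : chiAlt cs hM (t + 1) t (k + 1) =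
    chi cs hM (lead t k) * chiAlt cs hM (t + 1) t k := by
  rw [chiAlt, chiAlt, prod_map_alternatingWord, prod_map_alternatingWord, altProd_succ,
    ← mul_assoc, e_mul_chi, ← mul_assoc, chi_mul_e]

theorem isBlock_chiAlt (t : Fin 2) (k : ℕ) :
    IsBlock (pathHom cs hM (chiAlt cs hM (t + 1) t k)) (vBot cs hM) (vBot cs hM)
      (altProd (genX M) t k) := by
  induction k with
  | zero => rw [chiAlt_zero]; exact isBlock_pathHom_e cs hM _
  | succ k ih =>
    rw [chiAlt_succ, map_mul, chi, map_mul, altProd_succ]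
    have := ((isBlock_uBot cs hM (lead t k)).mul (isBlock_dBot cs hM (lead t k))).mul ih
    rwa [one_mul] at this

theorem isBlock_sum_chiAlt (i s : Fin 2) (F : Finset ℕ) (c : ℕ → ℤ[X]) :
    IsBlock (pathHom cs hM (dBot cs hM i *
        (∑ j ∈ F, c j • chiAlt cs hM s (s + 1) (j - 2)) * uBot cs hM s)) (vMid cs hM i)
      (vMid cs hM s) (genX M i * ∑ j ∈ F, c j • altProd (genX M) (s + 1) (j - 2)) := by
  have h : ∀ j ∈ F, IsBlock (pathHom cs hM (c j • chiAlt cs hM s (s + 1) (j - 2))) (vBot cs hM)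
      (vBot cs hM) (c j • altProd (genX M) (s + 1) (j - 2)) := by
    intro j _
    have := isBlock_chiAlt cs hM (s + 1) (j - 2)
    rw [fin_two_add_one_add_one] at this
    rw [map_smul]
    exact this.smul _
  have := ((isBlock_dBot cs hM i).mul (IsBlock.sum F h)).mul (isBlock_uBot cs hM s)
  rw [mul_one] at this
  rw [map_mul, map_mul, map_sum]
  exact this

include hM in
-- From each product of length at least 2 both outer factors are split off; the product of length 1
-- cannot be split and becomes the extra idempotent term for odd n.
theorem heckeSum_eq_refined (s : Fin 2) : heckeSum M =
    genX M (lead s (M 0 1 - 1)) * (∑ k ∈ Finset.range (M 0 1 - 1), bCoeff (M 0 1) (k + 2) •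
      altProd (genX M) (s + 1) k) * genX M s + bCoeff (M 0 1) 1 • genX M s := by
  obtain ⟨m, hm⟩ : ∃ m, M 0 1 = m + 1 := ⟨M 0 1 - 1, by omega⟩
  rw [heckeSum_eq_sum_bCoeff hM s, hm, Finset.sum_range_succ', Nat.add_sub_cancel, Finset.mul_sum,
    Finset.sum_mul]
  congr 1
  · refine Finset.sum_congr rfl fun k hk => ?_
    rw [mul_smul_comm, smul_mul_assoc]
    by_cases h : Even (m + 1 - (k + 1 + 1))
    · have hk' : k + 1 ≤ m := by have := Finset.mem_range.1 hk; omega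
      rw [lead_eq_of_even_sub s hk' h, mul_assoc, ← altProd_succ', ← altProd_succ]
    · rw [bCoeff_eq_zero_of_not_even h, zero_smul, zero_smul]
  · rw [altProd_one]

theorem pathHom_rel {a b : HassePath cs} (h : DihedralRel cs hM a b) :
    pathHom cs hM a = pathHom cs hM b := by
  have hn := two_le_matrix_apply hM
  cases h with
  | quasiIdempotentBot i =>
    rw [map_mul, map_smul]
    refine ((isBlock_dBot cs hM i).mul (isBlock_uBot cs hM i)).ext
      ((isBlock_pathHom_e cs hM _).smul _) ?_
    rw [heckeX_vMid, mul_one, one_add_mul_self (R := Hecke M) (gen_mul_self M), smul_mul_assoc,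
      one_mul]
  | quasiIdempotentTop i =>
    rw [map_mul, map_smul]
    refine ((isBlock_dTop cs hM i).mul (isBlock_uTop cs hM i)).ext
      ((isBlock_pathHom_e cs hM _).smul _) ?_
    rw [heckeX_vTop, mul_one, cosetWeight_mul_heckeSum hM, smul_mul_assoc, one_mul]
  | sandwichUpsilon =>
    rw [map_mul, map_mul]
    exact ((isBlock_uBot cs hM 0).mul (isBlock_uTop cs hM 0)).ext
      ((isBlock_uBot cs hM 1).mul (isBlock_uTop cs hM 1)) rfl
  | sandwichDelta =>
    rw [map_mul, map_mul]
    refine ((isBlock_dTop cs hM 0).mul (isBlock_dBot cs hM 0)).ext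
      ((isBlock_dTop cs hM 1).mul (isBlock_dBot cs hM 1)) ?_
    rw [cosetWeight_mul_genX hM, cosetWeight_mul_genX hM]
  | refinedBraidEven s t hst hn' =>
    obtain rfl := fin_two_eq_add_one hst.symm
    rw [map_mul]
    refine ((isBlock_uTop cs hM (s + 1)).mul (isBlock_dTop cs hM s)).ext
      (isBlock_sum_chiAlt cs hM (s + 1) s _ _) ?_
    rw [heckeX_vMid, one_mul, cosetWeight_mul_genX hM, heckeSum_eq_refined hM s,
      bCoeff_one_of_even hn', zero_smul, add_zero, sum_Icc_two_bCoeff,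
      lead_sub_one_of_even s hM hn']
  | refinedBraidOdd s t hst hn' =>
    obtain rfl := fin_two_eq_add_one hst.symm
    rw [map_mul, map_add, map_smul]
    refine ((isBlock_uTop cs hM s).mul (isBlock_dTop cs hM s)).ext
      ((isBlock_sum_chiAlt cs hM s s _ _).add ((isBlock_pathHom_e cs hM _).smul _)) ?_
    rw [heckeX_vMid, one_mul, cosetWeight_mul_genX hM, heckeSum_eq_refined hM s,
      bCoeff_one_of_odd hn', sum_Icc_three_bCoeff hn', lead_sub_one_of_odd s hn',
      add_mul (genX M s * _), smul_mul_assoc, one_mul]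

/-- The homomorphism from the quotient of the path algebra to the Hecke endomorphism algebra. -/
def quotHom : RingQuot (DihedralRel cs hM) →ₐ[ℤ[X]] HeckeEnd cs :=
  RingQuot.liftAlgHom ℤ[X] ⟨pathHom cs hM, fun _ _ h => pathHom_rel cs hM h⟩

theorem quotHom_mk (a : HassePath cs) :
    quotHom cs hM (RingQuot.mkAlgHom ℤ[X] (DihedralRel cs hM) a) = pathHom cs hM a :=
  RingQuot.liftAlgHom_mkAlgHom_apply _ _ _ _

end Action

/-! ### Standard elements of the quotient of the path algebra -/

section Quotient

variable {W : Type*} [Group W] {M : CoxeterMatrix (Fin 2)} (cs : CoxeterSystem M W)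
  (hM : M 0 1 ≠ 0)

/-- The quotient of the path algebra by the defining relations. -/
abbrev DihedralQuot := RingQuot (DihedralRel cs hM)

/-- The projection of the path algebra onto its quotient. -/
def quotMk : HassePath cs →ₐ[ℤ[X]] DihedralQuot cs hM := RingQuot.mkAlgHom ℤ[X] (DihedralRel cs hM)

theorem quotMk_rel {a b : HassePath cs} (h : DihedralRel cs hM a b) :
    quotMk cs hM a = quotMk cs hM b := RingQuot.mkAlgHom_rel ℤ[X] h

/-- The image of a trivial path. -/
def qE (I : Finitary cs) : DihedralQuot cs hM := quotMk cs hM (PathAlgebra.e I)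

/-- The image of `δ_{i}`. -/
def qD (i : Fin 2) : DihedralQuot cs hM := quotMk cs hM (dBot cs hM i)

/-- The image of `υ_{i}`. -/
def qU (i : Fin 2) : DihedralQuot cs hM := quotMk cs hM (uBot cs hM i)

/-- The image of `δ_{S,{i}}`. -/
def qDT (i : Fin 2) : DihedralQuot cs hM := quotMk cs hM (dTop cs hM i)

/-- The image of `υ_{{i},S}`. -/
def qUT (i : Fin 2) : DihedralQuot cs hM := quotMk cs hM (uTop cs hM i)

theorem qE_mul_self (I : Finitary cs) : qE cs hM I * qE cs hM I = qE cs hM I := by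
  rw [qE, ← map_mul, PathAlgebra.e_mul_e]

theorem qE_mul_qD (i : Fin 2) : qE cs hM (vMid cs hM i) * qD cs hM i = qD cs hM i := by
  rw [qE, qD, ← map_mul, dBot, delta, PathAlgebra.e_mul_arrow]

theorem qD_mul_qE (i : Fin 2) : qD cs hM i * qE cs hM (vBot cs hM) = qD cs hM i := by
  rw [qE, qD, ← map_mul, dBot, delta, PathAlgebra.arrow_mul_e]

theorem qE_mul_qU (i : Fin 2) : qE cs hM (vBot cs hM) * qU cs hM i = qU cs hM i := by
  rw [qE, qU, ← map_mul, uBot, upsilon, PathAlgebra.e_mul_arrow]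

theorem qU_mul_qE (i : Fin 2) : qU cs hM i * qE cs hM (vMid cs hM i) = qU cs hM i := by
  rw [qE, qU, ← map_mul, uBot, upsilon, PathAlgebra.arrow_mul_e]

theorem qE_mul_qDT (i : Fin 2) : qE cs hM (vTop cs hM) * qDT cs hM i = qDT cs hM i := by
  rw [qE, qDT, ← map_mul, dTop, delta, PathAlgebra.e_mul_arrow]

theorem qDT_mul_qE (i : Fin 2) : qDT cs hM i * qE cs hM (vMid cs hM i) = qDT cs hM i := by
  rw [qE, qDT, ← map_mul, dTop, delta, PathAlgebra.arrow_mul_e]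

theorem qE_mul_qUT (i : Fin 2) : qE cs hM (vMid cs hM i) * qUT cs hM i = qUT cs hM i := by
  rw [qE, qUT, ← map_mul, uTop, upsilon, PathAlgebra.e_mul_arrow]

theorem qUT_mul_qE (i : Fin 2) : qUT cs hM i * qE cs hM (vTop cs hM) = qUT cs hM i := by
  rw [qE, qUT, ← map_mul, uTop, upsilon, PathAlgebra.arrow_mul_e]

theorem qD_mul_qU (i : Fin 2) :
    qD cs hM i * qU cs hM i = (1 + X : ℤ[X]) • qE cs hM (vMid cs hM i) := by
  rw [qD, qU, qE, ← map_mul, ← map_smul]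
  exact quotMk_rel cs hM (.quasiIdempotentBot i)

theorem qDT_mul_qUT (i : Fin 2) : qDT cs hM i * qUT cs hM i =
    (∑ k ∈ Finset.range (M 0 1), X ^ k : ℤ[X]) • qE cs hM (vTop cs hM) := by
  rw [qDT, qUT, qE, ← map_mul, ← map_smul]
  exact quotMk_rel cs hM (.quasiIdempotentTop i)

theorem qU_mul_qUT (i : Fin 2) : qU cs hM i * qUT cs hM i = qU cs hM 0 * qUT cs hM 0 := by
  have h : qU cs hM 0 * qUT cs hM 0 = qU cs hM 1 * qUT cs hM 1 := by
    simp only [qU, qUT, ← map_mul]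
    exact quotMk_rel cs hM .sandwichUpsilon
  fin_cases i
  · rfl
  · exact h.symm

theorem qDT_mul_qD (i : Fin 2) : qDT cs hM i * qD cs hM i = qDT cs hM 0 * qD cs hM 0 := by
  have h : qDT cs hM 0 * qD cs hM 0 = qDT cs hM 1 * qD cs hM 1 := by
    simp only [qD, qDT, ← map_mul]
    exact quotMk_rel cs hM .sandwichDelta
  fin_cases i
  · rfl
  · exact h.symm

/-- The alternating products `⋯ δ_{j} υ_{j + 1} δ_{j + 1} υ_{j}` with `k` factors `δ` and
`k` factors `υ`. -/
def zigzag (j : Fin 2) : ℕ → DihedralQuot cs hM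
  | 0 => qE cs hM (vMid cs hM j)
  | k + 1 => qD cs hM (lead j (k + 1)) * (qU cs hM (lead j k) * zigzag j k)

theorem qE_mul_zigzag (j : Fin 2) (k : ℕ) :
    qE cs hM (vMid cs hM (lead j k)) * zigzag cs hM j k = zigzag cs hM j k := by
  cases k with
  | zero => exact qE_mul_self cs hM _
  | succ k => rw [zigzag, ← mul_assoc, qE_mul_qD]

theorem qU_mul_zigzag (s : Fin 2) (k : ℕ) : qU cs hM (lead s k) * zigzag cs hM s k =
    quotMk cs hM (chiAlt cs hM s (s + 1) k) * qU cs hM s := by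
  induction k with
  | zero =>
    have := chiAlt_zero cs hM (s + 1)
    rw [fin_two_add_one_add_one] at this
    rw [this, zigzag, lead_zero, qU_mul_qE]
    exact (qE_mul_qU cs hM s).symm
  | succ k ih =>
    have := chiAlt_succ cs hM (s + 1) k
    rw [fin_two_add_one_add_one, lead_add_one] at this
    rw [this, zigzag, ih, lead_succ, map_mul, chi, map_mul, ← mul_assoc, ← mul_assoc]
    rfl

theorem zigzag_succ (s : Fin 2) (k : ℕ) : zigzag cs hM s (k + 1) =
    qD cs hM (lead s (k + 1)) * quotMk cs hM (chiAlt cs hM s (s + 1) k) * qU cs hM s := by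
  rw [zigzag, qU_mul_zigzag, mul_assoc]

theorem quotMk_refined (i s : Fin 2) (hi : i = lead s (M 0 1 - 1)) :
    quotMk cs hM (dBot cs hM i * (∑ k ∈ Finset.range (M 0 1 - 1), bCoeff (M 0 1) (k + 2) •
      chiAlt cs hM s (s + 1) k) * uBot cs hM s) =
      ∑ k ∈ Finset.range (M 0 1 - 1), bCoeff (M 0 1) (k + 2) • zigzag cs hM s (k + 1) := by
  obtain ⟨m, hm⟩ : ∃ m, M 0 1 = m + 1 := ⟨M 0 1 - 1, by omega⟩
  rw [Finset.mul_sum, Finset.sum_mul, map_sum]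
  refine Finset.sum_congr rfl fun k hk => ?_
  rw [mul_smul_comm, smul_mul_assoc, map_smul]
  by_cases h : Even (M 0 1 - (k + 2))
  · rw [hm, Nat.add_sub_cancel] at hk hi
    rw [hm] at h
    have hk' : k + 1 ≤ m := by have := Finset.mem_range.1 hk; omega
    rw [hi, lead_eq_of_even_sub s hk' h, zigzag_succ, map_mul, map_mul]
    rfl
  · rw [bCoeff_eq_zero_of_not_even h, zero_smul, zero_smul]

/-- Both parities of the refined braid relation in one formula: `lead s (n - 1)` is the other letter
for even n and s for odd n, and the k = 0 term vanishes for even n. -/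
theorem qUT_mul_qDT (s : Fin 2) : qUT cs hM (lead s (M 0 1 - 1)) * qDT cs hM s =
    ∑ k ∈ Finset.range (M 0 1), bCoeff (M 0 1) (k + 1) • zigzag cs hM s k := by
  obtain ⟨m, hm⟩ : ∃ m, M 0 1 = m + 1 := ⟨M 0 1 - 1, by omega⟩
  have e : ∑ k ∈ Finset.range (M 0 1), bCoeff (M 0 1) (k + 1) • zigzag cs hM s k =
      ∑ k ∈ Finset.range (M 0 1 - 1), bCoeff (M 0 1) (k + 2) • zigzag cs hM s (k + 1) +
        bCoeff (M 0 1) 1 • qE cs hM (vMid cs hM s) := by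
    conv_lhs => rw [show M 0 1 = M 0 1 - 1 + 1 by omega]
    rw [Finset.sum_range_succ', show M 0 1 - 1 + 1 = M 0 1 by omega]
    rfl
  rw [e, ← quotMk_refined cs hM _ s rfl, qUT, qDT, qE, ← map_mul, ← map_smul, ← map_add]
  rcases Nat.even_or_odd (M 0 1) with hn | hn
  · rw [bCoeff_one_of_even hn, zero_smul, add_zero, lead_sub_one_of_even s hM hn,
      ← sum_Icc_two_bCoeff]
    exact quotMk_rel cs hM (.refinedBraidEven s (s + 1) (fin_two_add_one_ne s).symm hn)
  · rw [bCoeff_one_of_odd hn, lead_sub_one_of_odd s hn, ← sum_Icc_three_bCoeff hn]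
    exact quotMk_rel cs hM (.refinedBraidOdd s (s + 1) (fin_two_add_one_ne s).symm hn)

/-- The sandwich relation replaces the outermost δ by one that meets its own υ, and the
quasi-idempotent relation turns that pair into 1 + q. -/
theorem qDT_mul_zigzag (j : Fin 2) (k : ℕ) : qDT cs hM (lead j k) * zigzag cs hM j k =
    ((1 + X) ^ k : ℤ[X]) • qDT cs hM j := by
  induction k with
  | zero => rw [zigzag, lead_zero, qDT_mul_qE, pow_zero, one_smul]
  | succ k ih =>
    rw [zigzag, ← mul_assoc, qDT_mul_qD, ← qDT_mul_qD cs hM (lead j k), mul_assoc,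
      ← mul_assoc (qD cs hM _), qD_mul_qU, smul_mul_assoc, mul_smul_comm, qE_mul_zigzag, ih,
      smul_smul, pow_succ']

open Classical in
/-- The path from `{i}` to `J` that does not meet `S`, or zero. -/
def outMid (J : Finitary cs) (i : Fin 2) : DihedralQuot cs hM :=
  if J = vBot cs hM then qU cs hM i else
    if J = vMid cs hM i then qE cs hM (vMid cs hM i) else 0

open Classical in
/-- The path from `I` to `{j}` that does not meet `S`, or zero. -/
def inMid (j : Fin 2) (I : Finitary cs) : DihedralQuot cs hM :=
  if I = vBot cs hM then qD cs hM j else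
    if I = vMid cs hM j then qE cs hM (vMid cs hM j) else 0

open Classical in
/-- The descending path from `S` to `J`. -/
def fromTop (J : Finitary cs) : DihedralQuot cs hM :=
  if J = vBot cs hM then qU cs hM 0 * qUT cs hM 0 else
    if J = vMid cs hM 0 then qUT cs hM 0 else
      if J = vMid cs hM 1 then qUT cs hM 1 else qE cs hM (vTop cs hM)

open Classical in
/-- The ascending path from `I` to `S`. -/
def toTop (I : Finitary cs) : DihedralQuot cs hM :=
  if I = vBot cs hM then qDT cs hM 0 * qD cs hM 0 else
    if I = vMid cs hM 0 then qDT cs hM 0 else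
      if I = vMid cs hM 1 then qDT cs hM 1 else qE cs hM (vTop cs hM)

theorem outMid_vBot (i : Fin 2) : outMid cs hM (vBot cs hM) i = qU cs hM i := if_pos rfl

theorem outMid_vMid_self (i : Fin 2) :
    outMid cs hM (vMid cs hM i) i = qE cs hM (vMid cs hM i) := by simp [outMid]

theorem outMid_vMid_of_ne {i j : Fin 2} (h : i ≠ j) : outMid cs hM (vMid cs hM i) j = 0 := by
  simp [outMid, h]

theorem outMid_vTop (i : Fin 2) : outMid cs hM (vTop cs hM) i = 0 := by
  simp [outMid, (vMid_ne_vTop cs hM i).symm]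

theorem inMid_vBot (i : Fin 2) : inMid cs hM i (vBot cs hM) = qD cs hM i := if_pos rfl

theorem inMid_vMid_self (i : Fin 2) :
    inMid cs hM i (vMid cs hM i) = qE cs hM (vMid cs hM i) := by simp [inMid]

theorem inMid_vMid_of_ne {i j : Fin 2} (h : i ≠ j) : inMid cs hM j (vMid cs hM i) = 0 := by
  simp [inMid, h]

theorem inMid_vTop (i : Fin 2) : inMid cs hM i (vTop cs hM) = 0 := by
  simp [inMid, (vMid_ne_vTop cs hM i).symm]

theorem fromTop_vBot : fromTop cs hM (vBot cs hM) = qU cs hM 0 * qUT cs hM 0 := if_pos rfl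

theorem fromTop_vMid (i : Fin 2) : fromTop cs hM (vMid cs hM i) = qUT cs hM i := by
  fin_cases i <;> simp [fromTop]

theorem fromTop_vTop : fromTop cs hM (vTop cs hM) = qE cs hM (vTop cs hM) := by
  simp [fromTop, (vMid_ne_vTop cs hM _).symm]

theorem toTop_vBot : toTop cs hM (vBot cs hM) = qDT cs hM 0 * qD cs hM 0 := if_pos rfl

theorem toTop_vMid (i : Fin 2) : toTop cs hM (vMid cs hM i) = qDT cs hM i := by
  fin_cases i <;> simp [toTop]

theorem toTop_vTop : toTop cs hM (vTop cs hM) = qE cs hM (vTop cs hM) := by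
  simp [toTop, (vMid_ne_vTop cs hM _).symm]

/-! ### Standard elements and their stability under arrows -/

theorem qDT_mul_inMid (j : Fin 2) (I : Finitary cs) :
    qDT cs hM j * inMid cs hM j I = toTop cs hM I ∨ qDT cs hM j * inMid cs hM j I = 0 := by
  rcases vertex_cases cs hM I with rfl | ⟨i, rfl⟩ | rfl
  · left
    rw [inMid_vBot, toTop_vBot, qDT_mul_qD]
  · by_cases h : i = j
    · subst h
      left
      rw [inMid_vMid_self, toTop_vMid, qDT_mul_qE]
    · right
      rw [inMid_vMid_of_ne cs hM h, mul_zero]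
  · right
    rw [inMid_vTop, mul_zero]

open Classical in
/-- The standard elements of the quotient of the path algebra. -/
def stdElt (J I : Finitary cs) : BasisIdx M → DihedralQuot cs hM
  | none => if J = vBot cs hM ∧ I = vBot cs hM then qE cs hM (vBot cs hM) else 0
  | some none => fromTop cs hM J * toTop cs hM I
  | some (some (j, k)) => outMid cs hM J (lead j k) * zigzag cs hM j k * inMid cs hM j I

/-- The span of the standard elements. -/
def stdSpan : Submodule ℤ[X] (DihedralQuot cs hM) :=
  Submodule.span ℤ[X] {a | ∃ J I β, stdElt cs hM J I β = a}

theorem stdElt_mem (J I : Finitary cs) (β : BasisIdx M) : stdElt cs hM J I β ∈ stdSpan cs hM :=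
  Submodule.subset_span (Exists.intro J (Exists.intro I (Exists.intro β rfl)))

theorem fromTop_mul_toTop_mem (J I : Finitary cs) :
    fromTop cs hM J * toTop cs hM I ∈ stdSpan cs hM := stdElt_mem cs hM J I (some none)

/-- The scalar -1 supplies the subtraction that a commutative monoid lacks. -/
theorem mem_of_add_mem {N : Type*} [AddCommMonoid N] [Module ℤ[X] N] {p : Submodule ℤ[X] N}
    {x y : N} (h : x + y ∈ p) (hx : x ∈ p) : y ∈ p := by
  have h0 : (-1 : ℤ[X]) • x + x = 0 := by
    nth_rewrite 2 [← one_smul ℤ[X] x]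
    rw [← add_smul, neg_add_cancel, zero_smul]
  have := p.add_mem (p.smul_mem (-1) hx) h
  rwa [← add_assoc, h0, zero_add] at this

theorem qDT_mul_inMid_mem {p : Submodule ℤ[X] (DihedralQuot cs hM)} (a : DihedralQuot cs hM)
    (I : Finitary cs) (h : a * toTop cs hM I ∈ p) (j : Fin 2) :
    a * (qDT cs hM j * inMid cs hM j I) ∈ p := by
  rcases qDT_mul_inMid cs hM j I with h' | h'
  · rwa [h']
  · rw [h', mul_zero]
    exact p.zero_mem

/-- The refined braid relation is used here: its top coefficient is 1, so the zigzag of length n - 1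
is a path through S minus shorter zigzags. -/
theorem zigzag_mul_inMid_mem (j : Fin 2) {k : ℕ} (hk : k < M 0 1) (I : Finitary cs) :
    zigzag cs hM j k * inMid cs hM j I ∈ stdSpan cs hM := by
  have small : ∀ l < M 0 1 - 1, zigzag cs hM j l * inMid cs hM j I ∈ stdSpan cs hM := by
    intro l hl
    have := stdElt_mem cs hM (vMid cs hM (lead j l)) I (some (some (j, ⟨l, hl⟩)))
    rwa [stdElt, outMid_vMid_self, qE_mul_zigzag] at this
  by_cases hk' : k < M 0 1 - 1
  · exact small k hk'
  · have hm : M 0 1 = k + 1 := by omega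
    have h := qUT_mul_qDT cs hM j
    rw [hm, Nat.add_sub_cancel, Finset.sum_range_succ, bCoeff_self, one_smul] at h
    have hs : (∑ l ∈ Finset.range k, bCoeff (k + 1) (l + 1) • zigzag cs hM j l) *
        inMid cs hM j I ∈ stdSpan cs hM := by
      rw [Finset.sum_mul]
      refine Submodule.sum_mem _ fun l hl => ?_
      rw [smul_mul_assoc]
      exact Submodule.smul_mem _ _ (small l (by have := Finset.mem_range.1 hl; omega))
    refine mem_of_add_mem ?_ hs
    rw [← add_mul, ← h, mul_assoc]
    refine qDT_mul_inMid_mem cs hM _ I ?_ j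
    rw [← fromTop_vMid]
    exact fromTop_mul_toTop_mem cs hM _ I

theorem qE_mem (I : Finitary cs) : qE cs hM I ∈ stdSpan cs hM := by
  have hn := two_le_matrix_apply hM
  rcases vertex_cases cs hM I with rfl | ⟨i, rfl⟩ | rfl
  · have := stdElt_mem cs hM (vBot cs hM) (vBot cs hM) none
    rwa [stdElt, if_pos ⟨rfl, rfl⟩] at this
  · have := zigzag_mul_inMid_mem cs hM i (k := 0) (by omega) (vMid cs hM i)
    rwa [zigzag, inMid_vMid_self, qE_mul_self] at this
  · have := fromTop_mul_toTop_mem cs hM (vTop cs hM) (vTop cs hM)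
    rwa [fromTop_vTop, toTop_vTop, qE_mul_self] at this

theorem qD_mul_stdElt_mem (i : Fin 2) (I : Finitary cs) (β : BasisIdx M) :
    qD cs hM i * stdElt cs hM (vBot cs hM) I β ∈ stdSpan cs hM := by
  have hn := two_le_matrix_apply hM
  rcases β with _ | _ | ⟨j, k⟩
  · rw [stdElt]
    split_ifs with h
    · have := zigzag_mul_inMid_mem cs hM i (k := 0) (by omega) (vBot cs hM)
      rw [zigzag, inMid_vBot, qE_mul_qD] at this
      rwa [qD_mul_qE]
    · rw [mul_zero]
      exact Submodule.zero_mem _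
  · rw [stdElt, fromTop_vBot, ← qU_mul_qUT cs hM i, ← mul_assoc, ← mul_assoc, qD_mul_qU,
      smul_mul_assoc, smul_mul_assoc, qE_mul_qUT, ← fromTop_vMid]
    exact Submodule.smul_mem _ _ (fromTop_mul_toTop_mem cs hM _ I)
  · rw [stdElt, outMid_vBot, ← mul_assoc]
    by_cases hi : lead j k = i
    · subst hi
      rw [← mul_assoc, qD_mul_qU, smul_mul_assoc, smul_mul_assoc, qE_mul_zigzag]
      exact Submodule.smul_mem _ _ (zigzag_mul_inMid_mem cs hM j (by omega) I)
    -- The arrow δ lengthens the zigzag to k + 1, which can reach n - 1 but not exceed it.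
    · obtain rfl := fin_two_eq_add_one (Ne.symm hi)
      exact zigzag_mul_inMid_mem cs hM j (k := k + 1) (by omega) I

theorem qDT_mul_stdElt_mem (i : Fin 2) (I : Finitary cs) (β : BasisIdx M) :
    qDT cs hM i * stdElt cs hM (vMid cs hM i) I β ∈ stdSpan cs hM := by
  rcases β with _ | _ | ⟨j, k⟩
  · rw [stdElt, if_neg (fun h => vMid_ne_vBot cs hM i h.1), mul_zero]
    exact Submodule.zero_mem _
  · rw [stdElt, fromTop_vMid, ← mul_assoc, qDT_mul_qUT, smul_mul_assoc, ← fromTop_vTop]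
    exact Submodule.smul_mem _ _ (fromTop_mul_toTop_mem cs hM _ I)
  · rw [stdElt]
    by_cases hi : i = lead j k
    · subst hi
      rw [outMid_vMid_self, qE_mul_zigzag, ← mul_assoc, qDT_mul_zigzag, smul_mul_assoc,
        ← qE_mul_qDT, mul_assoc]
      refine Submodule.smul_mem _ _ (qDT_mul_inMid_mem cs hM _ I ?_ j)
      rw [← fromTop_vTop]
      exact fromTop_mul_toTop_mem cs hM _ I
    · rw [outMid_vMid_of_ne cs hM hi, zero_mul, zero_mul, mul_zero]
      exact Submodule.zero_mem _

theorem qU_mul_stdElt_mem (i : Fin 2) (I : Finitary cs) (β : BasisIdx M) :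
    qU cs hM i * stdElt cs hM (vMid cs hM i) I β ∈ stdSpan cs hM := by
  rcases β with _ | _ | ⟨j, k⟩
  · rw [stdElt, if_neg (fun h => vMid_ne_vBot cs hM i h.1), mul_zero]
    exact Submodule.zero_mem _
  · rw [stdElt, fromTop_vMid, ← mul_assoc, qU_mul_qUT, ← fromTop_vBot]
    exact fromTop_mul_toTop_mem cs hM _ I
  · rw [stdElt]
    by_cases hi : i = lead j k
    · subst hi
      have := stdElt_mem cs hM (vBot cs hM) I (some (some (j, k)))
      rw [stdElt, outMid_vBot] at this
      rwa [outMid_vMid_self, qE_mul_zigzag, ← mul_assoc]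
    · rw [outMid_vMid_of_ne cs hM hi, zero_mul, zero_mul, mul_zero]
      exact Submodule.zero_mem _

theorem qUT_mul_stdElt_mem (i : Fin 2) (I : Finitary cs) (β : BasisIdx M) :
    qUT cs hM i * stdElt cs hM (vTop cs hM) I β ∈ stdSpan cs hM := by
  rcases β with _ | _ | ⟨j, k⟩
  · rw [stdElt, if_neg (fun h => vTop_ne_vBot cs hM h.1), mul_zero]
    exact Submodule.zero_mem _
  · rw [stdElt, fromTop_vTop, ← mul_assoc, qUT_mul_qE, ← fromTop_vMid]
    exact fromTop_mul_toTop_mem cs hM _ I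
  · rw [stdElt, outMid_vTop, zero_mul, zero_mul, mul_zero]
    exact Submodule.zero_mem _

theorem qE_mul_stdElt (J I : Finitary cs) (β : BasisIdx M) :
    qE cs hM J * stdElt cs hM J I β = stdElt cs hM J I β := by
  rcases β with _ | _ | ⟨j, k⟩
  · rw [stdElt]
    split_ifs with h
    · rw [h.1, qE_mul_self]
    · rw [mul_zero]
  · rw [stdElt, ← mul_assoc]
    congr 1
    rcases vertex_cases cs hM J with rfl | ⟨i, rfl⟩ | rfl
    · rw [fromTop_vBot, ← mul_assoc, qE_mul_qU]
    · rw [fromTop_vMid, qE_mul_qUT]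
    · rw [fromTop_vTop, qE_mul_self]
  · rw [stdElt, ← mul_assoc, ← mul_assoc]
    congr 2
    rcases vertex_cases cs hM J with rfl | ⟨i, rfl⟩ | rfl
    · rw [outMid_vBot, qE_mul_qU]
    · by_cases h : i = lead j k
      · rw [← h, outMid_vMid_self, qE_mul_self]
      · rw [outMid_vMid_of_ne cs hM h, mul_zero]
    · rw [outMid_vTop, mul_zero]

/-- There are four kinds of arrows; an arrow whose source is not J annihilates the element. -/
theorem quotMk_arrow_mul_stdElt_mem {a b : Finitary cs} (f : a ⟶ b) (J I : Finitary cs)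
    (β : BasisIdx M) : quotMk cs hM (PathAlgebra.arrow f) * stdElt cs hM J I β ∈ stdSpan cs hM := by
  by_cases hJ : J = a
  · subst hJ
    rcases f with ⟨⟨h⟩⟩ | ⟨⟨h⟩⟩
    · rcases covers_cases cs hM h with ⟨i, rfl, rfl⟩ | ⟨i, rfl, rfl⟩
      · exact qD_mul_stdElt_mem cs hM i I β
      · exact qDT_mul_stdElt_mem cs hM i I β
    · rcases covers_cases cs hM h with ⟨i, rfl, rfl⟩ | ⟨i, rfl, rfl⟩
      · exact qU_mul_stdElt_mem cs hM i I β
      · exact qUT_mul_stdElt_mem cs hM i I β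
  · have h : (PathAlgebra.arrow f * PathAlgebra.e J : HassePath cs) = 0 := by
      rw [PathAlgebra.arrow, PathAlgebra.e, PathAlgebra.ofPath_mul_ofPath,
        PathAlgebra.mulPath_of_ne _ _ hJ]
    rw [← qE_mul_stdElt, ← mul_assoc, qE, ← map_mul, h, map_zero, zero_mul]
    exact Submodule.zero_mem _

/-- A path is built by adding arrows on the left of a trivial path, and the span contains the
trivial paths and is stable under that operation. -/
theorem stdSpan_eq_top : stdSpan cs hM = ⊤ := by
  rw [Submodule.eq_top_iff']
  intro a
  obtain ⟨a, rfl⟩ := RingQuot.mkAlgHom_surjective ℤ[X] (DihedralRel cs hM) a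
  change quotMk cs hM a ∈ _
  induction a using PathAlgebra.induction_on with
  | zero => rw [map_zero]; exact Submodule.zero_mem _
  | add x y hx hy => rw [map_add]; exact Submodule.add_mem _ hx hy
  | smul r x hx => rw [map_smul]; exact Submodule.smul_mem _ _ hx
  | path p =>
    obtain ⟨a, b, p⟩ := p
    induction p with
    | nil => exact qE_mem cs hM a
    | cons p f ih =>
      rw [← PathAlgebra.arrow_mul_ofPath, map_mul]
      have hle : stdSpan cs hM ≤ (stdSpan cs hM).comap
          (LinearMap.mulLeft ℤ[X] (quotMk cs hM (PathAlgebra.arrow f))) := by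
        refine Submodule.span_le.2 ?_
        rintro _ ⟨J, I, β, rfl⟩
        exact quotMk_arrow_mul_stdElt_mem cs hM f J I β
      exact hle ih

end Quotient

/-! ### The isomorphism -/

section Isomorphism

variable {W : Type*} [Group W] {M : CoxeterMatrix (Fin 2)} (cs : CoxeterSystem M W)
  (hM : M 0 1 ≠ 0)

/-- The basis elements that lie in `x_J H_q ∩ H_q x_I`. -/
def BasisIdx.Compat (J I : Finitary cs) (β : BasisIdx M) : Prop :=
  (∀ i ∈ J.1, β.Starts i) ∧ ∀ i ∈ I.1, β.Ends i

theorem isBlock_qE (I : Finitary cs) : IsBlock (quotHom cs hM (qE cs hM I)) I I 1 := by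
  rw [qE, quotMk, quotHom_mk]
  exact isBlock_pathHom_e cs hM I

theorem isBlock_qD (i : Fin 2) :
    IsBlock (quotHom cs hM (qD cs hM i)) (vMid cs hM i) (vBot cs hM) (genX M i) := by
  rw [qD, quotMk, quotHom_mk]
  exact isBlock_dBot cs hM i

theorem isBlock_qU (i : Fin 2) :
    IsBlock (quotHom cs hM (qU cs hM i)) (vBot cs hM) (vMid cs hM i) 1 := by
  rw [qU, quotMk, quotHom_mk]
  exact isBlock_uBot cs hM i

theorem isBlock_qDT (i : Fin 2) :
    IsBlock (quotHom cs hM (qDT cs hM i)) (vTop cs hM) (vMid cs hM i) (cosetWeight M i) := by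
  rw [qDT, quotMk, quotHom_mk]
  exact isBlock_dTop cs hM i

theorem isBlock_qUT (i : Fin 2) :
    IsBlock (quotHom cs hM (qUT cs hM i)) (vMid cs hM i) (vTop cs hM) 1 := by
  rw [qUT, quotMk, quotHom_mk]
  exact isBlock_uTop cs hM i

theorem isBlock_zigzag (j : Fin 2) (k : ℕ) :
    IsBlock (quotHom cs hM (zigzag cs hM j k)) (vMid cs hM (lead j k)) (vMid cs hM j)
      (altProd (genX M) (j + 1) k) := by
  induction k with
  | zero => exact isBlock_qE cs hM _
  | succ k ih =>
    rw [zigzag, map_mul, map_mul, altProd_succ, lead_add_one]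
    have := (isBlock_qD cs hM (lead j (k + 1))).mul ((isBlock_qU cs hM (lead j k)).mul ih)
    rwa [one_mul] at this

theorem isBlock_fromTop (J : Finitary cs) :
    IsBlock (quotHom cs hM (fromTop cs hM J)) J (vTop cs hM) 1 := by
  rcases vertex_cases cs hM J with rfl | ⟨i, rfl⟩ | rfl
  · rw [fromTop_vBot, map_mul]
    have := (isBlock_qU cs hM 0).mul (isBlock_qUT cs hM 0)
    rwa [one_mul] at this
  · rw [fromTop_vMid]
    exact isBlock_qUT cs hM i
  · rw [fromTop_vTop]
    exact isBlock_qE cs hM _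

theorem exists_isBlock_toTop (I : Finitary cs) :
    ∃ y, IsBlock (quotHom cs hM (toTop cs hM I)) (vTop cs hM) I y ∧
      y * heckeX cs I = heckeSum M := by
  rcases vertex_cases cs hM I with rfl | ⟨i, rfl⟩ | rfl
  · refine ⟨cosetWeight M 0 * genX M 0, ?_, ?_⟩
    · rw [toTop_vBot, map_mul]
      exact (isBlock_qDT cs hM 0).mul (isBlock_qD cs hM 0)
    · rw [heckeX_vBot, mul_one, cosetWeight_mul_genX hM]
  · refine ⟨cosetWeight M i, ?_, ?_⟩
    · rw [toTop_vMid]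
      exact isBlock_qDT cs hM i
    · rw [heckeX_vMid, cosetWeight_mul_genX hM]
  · refine ⟨1, ?_, ?_⟩
    · rw [toTop_vTop]
      exact isBlock_qE cs hM _
    · rw [heckeX_vTop, one_mul]

theorem isBlock_outMid {J : Finitary cs} {l : Fin 2} (h : ∀ i ∈ J.1, l = i) :
    IsBlock (quotHom cs hM (outMid cs hM J l)) J (vMid cs hM l) 1 := by
  rcases vertex_cases cs hM J with rfl | ⟨i, rfl⟩ | rfl
  · rw [outMid_vBot]
    exact isBlock_qU cs hM l
  · obtain rfl : l = i := h i (Finset.mem_singleton_self i)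
    rw [outMid_vMid_self]
    exact isBlock_qE cs hM _
  · exact absurd (h (l + 1) (Finset.mem_univ _)) (fin_two_add_one_ne l).symm

theorem exists_isBlock_inMid {I : Finitary cs} {j : Fin 2} (h : ∀ i ∈ I.1, j = i) :
    ∃ y, IsBlock (quotHom cs hM (inMid cs hM j I)) (vMid cs hM j) I y ∧
      y * heckeX cs I = genX M j := by
  rcases vertex_cases cs hM I with rfl | ⟨i, rfl⟩ | rfl
  · refine ⟨genX M j, ?_, ?_⟩
    · rw [inMid_vBot]
      exact isBlock_qD cs hM j
    · rw [heckeX_vBot, mul_one]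
  · obtain rfl : j = i := h i (Finset.mem_singleton_self i)
    refine ⟨1, ?_, ?_⟩
    · rw [inMid_vMid_self]
      exact isBlock_qE cs hM _
    · rw [heckeX_vMid, one_mul]
  · exact absurd (h (j + 1) (Finset.mem_univ _)) (fin_two_add_one_ne j).symm

theorem eq_vBot_of_forall_not {J : Finitary cs} (h : ∀ i, i ∉ J.1) : J = vBot cs hM :=
  Subtype.ext (Finset.eq_empty_of_forall_notMem h)

theorem exists_isBlock_stdElt {J I : Finitary cs} {β : BasisIdx M} (h : β.Compat cs J I) :
    ∃ y, IsBlock (quotHom cs hM (stdElt cs hM J I β)) J I y ∧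
      y * heckeX cs I = basisVec M β := by
  rcases β with _ | _ | ⟨j, k⟩
  · obtain rfl := eq_vBot_of_forall_not cs hM h.1
    obtain rfl := eq_vBot_of_forall_not cs hM h.2
    refine ⟨1, ?_, ?_⟩
    · rw [stdElt, if_pos ⟨rfl, rfl⟩]
      exact isBlock_qE cs hM _
    · rw [heckeX_vBot, one_mul]
      rfl
  · obtain ⟨y, h1, h2⟩ := exists_isBlock_toTop cs hM I
    refine ⟨1 * y, ?_, ?_⟩
    · rw [stdElt, map_mul]
      exact (isBlock_fromTop cs hM J).mul h1
    · rw [one_mul, h2]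
      rfl
  · obtain ⟨y, h1, h2⟩ := exists_isBlock_inMid cs hM h.2
    refine ⟨1 * altProd (genX M) (j + 1) k * y, ?_, ?_⟩
    · rw [stdElt, map_mul, map_mul]
      exact ((isBlock_outMid cs hM h.1).mul (isBlock_zigzag cs hM j k)).mul h1
    · rw [one_mul, mul_assoc, h2, ← altProd_succ']
      rfl

/-- In the incompatible case no path avoiding S joins the ends, so `outMid` or `inMid` takes its
default value 0. -/
theorem stdElt_eq_zero {J I : Finitary cs} {β : BasisIdx M} (h : ¬ β.Compat cs J I) :
    stdElt cs hM J I β = 0 := by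
  rcases β with _ | _ | ⟨j, k⟩
  · rw [stdElt, if_neg]
    rintro ⟨rfl, rfl⟩
    exact h ⟨fun i hi => absurd hi (Finset.notMem_empty i),
      fun i hi => absurd hi (Finset.notMem_empty i)⟩
  · exact absurd ⟨fun _ _ => trivial, fun _ _ => trivial⟩ h
  · rw [stdElt]
    by_cases hJ : ∀ i ∈ J.1, lead j k = i
    · have hI : ¬ ∀ i ∈ I.1, j = i := fun hI => h ⟨hJ, hI⟩
      suffices inMid cs hM j I = 0 by rw [this, mul_zero]
      rcases vertex_cases cs hM I with rfl | ⟨i, rfl⟩ | rfl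
      · exact absurd (fun i hi => absurd hi (Finset.notMem_empty i)) hI
      · refine inMid_vMid_of_ne cs hM fun hij => hI fun i' hi' => ?_
        rw [← hij, Finset.mem_singleton.1 hi']
      · exact inMid_vTop cs hM j
    · suffices outMid cs hM J (lead j k) = 0 by rw [this, zero_mul, zero_mul]
      rcases vertex_cases cs hM J with rfl | ⟨i, rfl⟩ | rfl
      · exact absurd (fun i hi => absurd hi (Finset.notMem_empty i)) hJ
      · refine outMid_vMid_of_ne cs hM fun hij => hJ fun i' hi' => ?_
        rw [← hij, Finset.mem_singleton.1 hi']
      · exact outMid_vTop cs hM _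

theorem entry_stdElt_self {J I : Finitary cs} {β : BasisIdx M} (h : β.Compat cs J I) :
    entry J I (quotHom cs hM (stdElt cs hM J I β)) = basisVec M β := by
  obtain ⟨y, h1, h2⟩ := exists_isBlock_stdElt cs hM h
  rw [h1.entry_self, h2]

theorem entry_stdElt_of_ne {J I K L : Finitary cs} (β : BasisIdx M) (hne : ¬ (K = J ∧ L = I)) :
    entry K L (quotHom cs hM (stdElt cs hM J I β)) = 0 := by
  by_cases h : β.Compat cs J I
  · obtain ⟨y, h1, -⟩ := exists_isBlock_stdElt cs hM h
    exact h1.entry_of_ne hne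
  · rw [stdElt_eq_zero cs hM h, map_zero, map_zero]

/-! ### The inverse of the homomorphism -/

/-- The linear map that lifts `(J, I)`-entries of endomorphisms to the quotient of the
path algebra. -/
def entryLift (J I : Finitary cs) : Hecke M →ₗ[ℤ[X]] DihedralQuot cs hM :=
  (heckeBasis cs hM).constr ℤ[X] (stdElt cs hM J I)

theorem entryLift_basisVec (J I : Finitary cs) (β : BasisIdx M) :
    entryLift cs hM J I (basisVec M β) = stdElt cs hM J I β := by
  rw [← heckeBasis_apply cs hM, entryLift, Module.Basis.constr_basis]

/-- The linear inverse of `quotHom`. -/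
def quotInv : HeckeEnd cs →ₗ[ℤ[X]] DihedralQuot cs hM :=
  ∑ J : Finitary cs, ∑ I : Finitary cs, entryLift cs hM J I ∘ₗ entry J I

theorem quotInv_apply (φ : HeckeEnd cs) :
    quotInv cs hM φ = ∑ J, ∑ I, entryLift cs hM J I (entry J I φ) := by
  simp [quotInv, LinearMap.sum_apply]

/-- It suffices to check the spanning standard elements, whose images have at most one nonzero
entry. This yields injectivity without first proving the standard elements independent. -/
theorem quotInv_quotHom (a : DihedralQuot cs hM) : quotInv cs hM (quotHom cs hM a) = a := by
  have ha : a ∈ stdSpan cs hM := by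
    rw [stdSpan_eq_top]
    exact Submodule.mem_top
  induction ha using Submodule.span_induction with
  | zero => rw [map_zero, map_zero]
  | add x y _ _ hx hy => rw [map_add, map_add, hx, hy]
  | smul r x _ hx => rw [map_smul, map_smul, hx]
  | mem x hx =>
    obtain ⟨J, I, β, rfl⟩ := hx
    rw [quotInv_apply, Finset.sum_eq_single J, Finset.sum_eq_single I]
    · by_cases h : β.Compat cs J I
      · rw [entry_stdElt_self cs hM h, entryLift_basisVec]
      · rw [stdElt_eq_zero cs hM h, map_zero, map_zero, map_zero]
    · intro L _ hL
      rw [entry_stdElt_of_ne cs hM β fun h => hL h.2, map_zero]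
    · exact fun h => absurd (Finset.mem_univ _) h
    · intro K _ hK
      refine Finset.sum_eq_zero fun L _ => ?_
      rw [entry_stdElt_of_ne cs hM β fun h => hK h.1, map_zero]
    · exact fun h => absurd (Finset.mem_univ _) h

include hM in
theorem genX_mul_heckeX {J : Finitary cs} {i : Fin 2} (hi : i ∈ J.1) :
    genX M i * heckeX cs J = (1 + X : ℤ[X]) • heckeX cs J := by
  rcases vertex_cases cs hM J with rfl | ⟨i', rfl⟩ | rfl
  · exact absurd hi (Finset.notMem_empty i)
  · obtain rfl := Finset.mem_singleton.1 hi
    rw [heckeX_vMid]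
    exact one_add_mul_self (R := Hecke M) (gen_mul_self M) i
  · rw [heckeX_vTop, genX_mul_heckeSum hM]

include hM in
theorem heckeX_mul_genX {I : Finitary cs} {i : Fin 2} (hi : i ∈ I.1) :
    heckeX cs I * genX M i = (1 + X : ℤ[X]) • heckeX cs I := by
  rcases vertex_cases cs hM I with rfl | ⟨i', rfl⟩ | rfl
  · exact absurd hi (Finset.notMem_empty i)
  · obtain rfl := Finset.mem_singleton.1 hi
    rw [heckeX_vMid]
    exact one_add_mul_self (R := Hecke M) (gen_mul_self M) i
  · rw [heckeX_vTop, heckeSum_mul_genX hM]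

/-- The left equations come from the entry lying in x_J H_q, the right ones from linearity of φ.
Compatible basis vectors thus account for every endomorphism, which gives surjectivity. -/
theorem repr_entry_eq_zero (φ : HeckeEnd cs) {J I : Finitary cs} {β : BasisIdx M}
    (h : ¬ β.Compat cs J I) : (heckeBasis cs hM).repr (entry J I φ) β = 0 := by
  rw [BasisIdx.Compat, not_and_or] at h
  rcases h with h | h
  · push Not at h
    obtain ⟨i, hi, h⟩ := h
    refine heckeBasis_repr_eq_zero_of_left cs hM ?_ h
    obtain ⟨a, ha⟩ := exists_eq_heckeX_mul (entry_mem J I φ)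
    rw [ha, ← mul_assoc, genX_mul_heckeX cs hM hi, smul_mul_assoc]
  · push Not at h
    obtain ⟨i, hi, h⟩ := h
    exact heckeBasis_repr_eq_zero_of_right cs hM
      (entry_mul_eq_smul (heckeX_mul_genX cs hM hi) J φ) h

theorem quotHom_entryLift (J I : Finitary cs) (v : Hecke M) :
    quotHom cs hM (entryLift cs hM J I v) =
      ∑ β, (heckeBasis cs hM).repr v β • quotHom cs hM (stdElt cs hM J I β) := by
  conv_lhs => rw [← (heckeBasis cs hM).sum_repr v]
  rw [map_sum, map_sum]
  refine Finset.sum_congr rfl fun β _ => ?_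
  rw [map_smul, map_smul, heckeBasis_apply, entryLift_basisVec]

theorem entry_quotHom_entryLift_self (φ : HeckeEnd cs) (J I : Finitary cs) :
    entry J I (quotHom cs hM (entryLift cs hM J I (entry J I φ))) = entry J I φ := by
  rw [quotHom_entryLift, map_sum]
  conv_rhs => rw [← (heckeBasis cs hM).sum_repr (entry J I φ)]
  refine Finset.sum_congr rfl fun β _ => ?_
  rw [map_smul, heckeBasis_apply]
  by_cases h : β.Compat cs J I
  · rw [entry_stdElt_self cs hM h]
  · rw [repr_entry_eq_zero cs hM φ h, zero_smul, zero_smul]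

theorem entry_quotHom_entryLift_of_ne (v : Hecke M) {J I K L : Finitary cs}
    (hne : ¬ (K = J ∧ L = I)) : entry K L (quotHom cs hM (entryLift cs hM J I v)) = 0 := by
  rw [quotHom_entryLift, map_sum]
  refine Finset.sum_eq_zero fun β _ => ?_
  rw [map_smul, entry_stdElt_of_ne cs hM β hne, smul_zero]

theorem quotHom_quotInv (φ : HeckeEnd cs) : quotHom cs hM (quotInv cs hM φ) = φ := by
  refine entry_ext fun K L => ?_
  rw [quotInv_apply, map_sum, map_sum, Finset.sum_eq_single K, map_sum, map_sum,
    Finset.sum_eq_single L]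
  · exact entry_quotHom_entryLift_self cs hM φ K L
  · intro I _ hI
    exact entry_quotHom_entryLift_of_ne cs hM _ fun h => hI h.2.symm
  · exact fun h => absurd (Finset.mem_univ _) h
  · intro J _ hJ
    rw [map_sum, map_sum]
    exact Finset.sum_eq_zero fun I _ => entry_quotHom_entryLift_of_ne cs hM _ fun h => hJ h.1.symm
  · exact fun h => absurd (Finset.mem_univ _) h

end Isomorphism

end HeckeEndo

end

/-- The hypothesis `hM` says that the dihedral group `W` is finite; its order is `2n` with
`n = M 0 1 ≥ 2`. -/
theorem theorem7p3 {W : Type*} [Group W] {M : CoxeterMatrix (Fin 2)} (cs : CoxeterSystem M W)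
    (hM : M 0 1 ≠ 0) :
    Nonempty (RingQuot (HeckeEndo.DihedralRel cs hM) ≃ₐ[ℤ[X]] HeckeEndo.HeckeEnd cs) :=
  ⟨AlgEquiv.ofBijective (HeckeEndo.quotHom cs hM)
    ⟨Function.LeftInverse.injective (HeckeEndo.quotInv_quotHom cs hM),
      Function.RightInverse.surjective (HeckeEndo.quotHom_quotInv cs hM)⟩⟩
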